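/- Let $k$ be a field and let $R$ be a cocommutative Hopf algebra over $k$, with counit $\varepsilon$, augmentation ideal $\mathfrak a=\ker\varepsilon$, and let $R^\circ$ be its Hopf dual: the commutative Hopf algebra of all linear forms on $R$ that vanish on some two-sided ideal of finite codimension, with the operations dual to those of $R$. Let \[R^\dagger=\{f\in R^\circ : f(\mathfrak a^n)=0\text{ for some }n\ge 1\},\qquad R^{\mathrm{ab}}=R/\mathfrak C,\] where $\mathfrak C$ is the two-sided ideal generated by the commutators $xy-yx$ ($x,y\in R$). Group schemes are affine group schemes over $k$. Such a group scheme $G$ is called abelian if it is commutative, and unipotent if each nonzero representation of $G$ (that is, each nonzero right $\mathcal O(G)$-comodule) has a nonzero fixed vector. A morphism $G\to Q$ is a quotient map if $\mathcal O(Q)\to\mathcal O(G)$ is injective; it is the largest abelian (respectively unipotent) quotient of $G$ if moreover $Q$ is abelian (respectively unipotent) and each morphism from $G$ to an abelian (respectively unipotent) group scheme factors through $G\to Q$ in a unique way. Then: (1) The subspace $R^\dagger\subset R^\circ$ is a Hopf subalgebra. (2) The $k$-algebra $R^{\mathrm{ab}}$ has a unique structure of Hopf algebra such that $R\to R^{\mathrm{ab}}$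 is a morphism of Hopf algebras; with this structure $R^{\mathrm{ab}}$ is cocommutative. (3) The morphism $\mathrm{Spec}\,R^\circ\to\mathrm{Spec}\,(R^{\mathrm{ab}})^\circ$ induced by $R\to R^{\mathrm{ab}}$ is the largest abelian quotient of $\mathrm{Spec}\,R^\circ$. (4) The morphism $\mathrm{Spec}\,R^\circ\to\mathrm{Spec}\,R^\dagger$ induced by the inclusion $R^\dagger\subset R^\circ$ is the largest unipotent quotient of $\mathrm{Spec}\,R^\circ$. -/

import Mathlib

open CategoryTheory AlgebraicGeometry TensorProduct Coalgebra

universe u v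

namespace TensorProduct

/-- The linear form `v ⊗ w ↦ e v * e' w`. -/
noncomputable def formMul {k V W : Type*} [Field k] [AddCommGroup V] [Module k V]
    [AddCommGroup W] [Module k W] (e : V →ₗ[k] k) (e' : W →ₗ[k] k) : V ⊗[k] W →ₗ[k] k :=
  LinearMap.mul' k k ∘ₗ TensorProduct.map e e'

@[simp]
theorem formMul_tmul {k V W : Type*} [Field k] [AddCommGroup V] [Module k V]
    [AddCommGroup W] [Module k W] (e : V →ₗ[k] k) (e' : W →ₗ[k] k) (v : V) (w : W) :
    formMul e e' (v ⊗ₜ w) = e v * e' w := by simp [formMul]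

theorem formMul_map {k V W V' W' : Type*} [Field k] [AddCommGroup V] [Module k V]
    [AddCommGroup W] [Module k W] [AddCommGroup V'] [Module k V'] [AddCommGroup W'] [Module k W']
    (e : V →ₗ[k] k) (e' : W →ₗ[k] k) (a : V' →ₗ[k] V) (b : W' →ₗ[k] W) (t : V' ⊗[k] W') :
    formMul e e' (TensorProduct.map a b t) = formMul (e ∘ₗ a) (e' ∘ₗ b) t := by
  simp only [formMul, TensorProduct.map_comp, LinearMap.comp_apply]

theorem formMul_assoc {k V W U : Type*} [Field k] [AddCommGroup V] [Module k V]
    [AddCommGroup W] [Module k W] [AddCommGroup U] [Module k U]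
    (e : V →ₗ[k] k) (e' : W →ₗ[k] k) (e'' : U →ₗ[k] k) (t : (V ⊗[k] W) ⊗[k] U) :
    formMul e (formMul e' e'') (TensorProduct.assoc k V W U t) =
      formMul (formMul e e') e'' t := by
  have : formMul e (formMul e' e'') ∘ₗ (TensorProduct.assoc k V W U).toLinearMap =
      formMul (formMul e e') e'' := by
    ext v w x
    simp [mul_assoc]
  exact LinearMap.congr_fun this t

/-- If two families of linear forms separate the points of `V` and of `W`, their products separate
the points of `V ⊗ W`. -/
theorem eq_of_formMul_eq {k V W ι κ : Type*} [Field k] [AddCommGroup V] [Module k V]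
    [AddCommGroup W] [Module k W] (e : ι → V →ₗ[k] k) (e' : κ → W →ₗ[k] k)
    (he : ∀ v, (∀ i, e i v = 0) → v = 0) (he' : ∀ w, (∀ j, e' j w = 0) → w = 0)
    {s t : V ⊗[k] W} (h : ∀ i j, formMul (e i) (e' j) s = formMul (e i) (e' j) t) : s = t := by
  suffices H : ∀ t : V ⊗[k] W, (∀ i j, formMul (e i) (e' j) t = 0) → t = 0 by
    rw [← sub_eq_zero]
    exact H _ fun i j => by rw [map_sub, h, sub_self]
  intro t ht
  have h1 : ∀ i, (TensorProduct.lid k W) (LinearMap.rTensor W (e i) t) = 0 := by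
    intro i
    refine he' _ fun j => ?_
    rw [← ht i j]
    induction t using TensorProduct.induction_on with
    | zero => simp
    | tmul x y => simp
    | add x y hx hy =>
      have key : ∀ z : V ⊗[k] W, e' j ((TensorProduct.lid k W) (LinearMap.rTensor W (e i) z)) =
          formMul (e i) (e' j) z := by
        intro z
        induction z using TensorProduct.induction_on with
        | zero => simp
        | tmul x y => simp
        | add x y hx hy => simp only [map_add, hx, hy]
      exact key _
  classical
  let c := Module.Basis.ofVectorSpace k W
  apply (TensorProduct.equivFinsuppOfBasisRight (M := V) c).injective
  ext j
  rw [map_zero, Finsupp.zero_apply]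
  refine he _ fun i => ?_
  have key : ∀ z : V ⊗[k] W, e i (TensorProduct.equivFinsuppOfBasisRight (M := V) c z j) =
      c.coord j ((TensorProduct.lid k W) (LinearMap.rTensor W (e i) z)) := by
    intro z
    induction z using TensorProduct.induction_on with
    | zero => simp
    | tmul x y => simp [mul_comm]
    | add x y hx hy => simp only [map_add, Finsupp.add_apply, hx, hy]
  rw [key, h1, map_zero]

end TensorProduct

section FiniteDual

variable (k : Type u) [Field k] (R : Type v) [Ring R]

/-- A linear form on `R` belongs to the finite dual if it vanishes on a two-sided ideal of finite
codimension. -/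
def VanishesOnCofiniteIdeal [Algebra k R] (f : R →ₗ[k] k) : Prop :=
  ∃ I : Ideal R, I.IsTwoSided ∧ FiniteDimensional k (R ⧸ I.restrictScalars k) ∧ ∀ x ∈ I, f x = 0

variable {k R}

/-- A form that factors through an algebra map into a finite dimensional algebra. -/
theorem VanishesOnCofiniteIdeal.of_algHom [Algebra k R] {A : Type*} [Ring A] [Algebra k A]
    [FiniteDimensional k A] (φ : R →ₐ[k] A) (f : R →ₗ[k] k) (h : ∀ x, φ x = 0 → f x = 0) :
    VanishesOnCofiniteIdeal k R f := by
  refine ⟨RingHom.ker φ, inferInstance, ?_, fun x hx => h x hx⟩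
  have hk : (RingHom.ker φ).restrictScalars k = LinearMap.ker φ.toLinearMap := rfl
  rw [hk]
  exact Module.Finite.of_injective _ (LinearMap.ker_eq_bot.mp
    (Submodule.ker_liftQ_eq_bot' _ φ.toLinearMap rfl))

/-- Every form in the finite dual factors through a finite dimensional quotient algebra. -/
theorem VanishesOnCofiniteIdeal.exists_algHom [Algebra k R] {f : R →ₗ[k] k}
    (h : VanishesOnCofiniteIdeal k R f) :
    ∃ (A : Type v) (_ : Ring A) (_ : Algebra k A) (_ : FiniteDimensional k A) (φ : R →ₐ[k] A)
      (g : A →ₗ[k] k), ∀ x, f x = g (φ x) := by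
  obtain ⟨I, hI, hfin, hf⟩ := h
  refine ⟨R ⧸ I, inferInstance, inferInstance, ?_, Ideal.Quotient.mkₐ k I,
    (I.restrictScalars k).liftQ f hf, fun x => rfl⟩
  exact hfin

variable (k R)

open WithConv in
/-- The finite (Hopf) dual `R°` of a bialgebra, as a subalgebra of the convolution algebra of all
linear forms on `R`. -/
def finiteDualSubalgebra [Bialgebra k R] : Subalgebra k (WithConv (R →ₗ[k] k)) where
  carrier := {f | VanishesOnCofiniteIdeal k R f.ofConv}
  algebraMap_mem' c :=
    .of_algHom (Bialgebra.counitAlgHom k R) _ fun x hx => by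
      have : counit (R := k) x = 0 := hx
      simp [Algebra.algebraMap_eq_smul_one, this]
  add_mem' := by
    intro f g hf hg
    obtain ⟨A, _, _, _, φ, f', hf⟩ := VanishesOnCofiniteIdeal.exists_algHom hf
    obtain ⟨B, _, _, _, ψ, g', hg⟩ := VanishesOnCofiniteIdeal.exists_algHom hg
    refine .of_algHom (φ.prod ψ) _ fun x hx => ?_
    have h1 : φ x = 0 := congrArg Prod.fst hx
    have h2 : ψ x = 0 := congrArg Prod.snd hx
    simp [hf, hg, h1, h2]
  mul_mem' := by
    intro f g hf hg
    obtain ⟨A, _, _, _, φ, f', hf⟩ := VanishesOnCofiniteIdeal.exists_algHom hf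
    obtain ⟨B, _, _, _, ψ, g', hg⟩ := VanishesOnCofiniteIdeal.exists_algHom hg
    refine .of_algHom ((Algebra.TensorProduct.map φ ψ).comp (Bialgebra.comulAlgHom k R)) _
      fun x hx => ?_
    have hx' : TensorProduct.map φ.toLinearMap ψ.toLinearMap (comul (R := k) x) = 0 := hx
    have h1 : f.ofConv = f' ∘ₗ φ.toLinearMap := LinearMap.ext hf
    have h2 : g.ofConv = g' ∘ₗ ψ.toLinearMap := LinearMap.ext hg
    rw [LinearMap.convMul_apply, h1, h2, TensorProduct.map_comp, LinearMap.comp_apply, hx',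
      map_zero, map_zero]

/-- The type `R°`: linear forms on `R` vanishing on a two-sided ideal of finite codimension. -/
def FiniteDual [Bialgebra k R] : Type max u v := finiteDualSubalgebra k R

end FiniteDual

namespace FiniteDual

variable {k : Type u} [Field k] {R : Type v} [Ring R]

section Bialg
variable [Bialgebra k R]

noncomputable instance : Ring (FiniteDual k R) :=
  inferInstanceAs (Ring (finiteDualSubalgebra k R))

noncomputable instance : Algebra k (FiniteDual k R) :=
  inferInstanceAs (Algebra k (finiteDualSubalgebra k R))

/-- The underlying linear form of an element of `R°`. -/
def toLin (f : FiniteDual k R) : R →ₗ[k] k := f.1.ofConv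

instance : CoeFun (FiniteDual k R) fun _ => R → k := ⟨fun f => toLin f⟩

/-- Evaluation at `x : R`, as a linear form on the finite dual. -/
noncomputable def ev (x : R) : FiniteDual k R →ₗ[k] k where
  toFun f := f x
  map_add' _ _ := rfl
  map_smul' _ _ := rfl

@[simp] theorem ev_apply (x : R) (f : FiniteDual k R) : ev x f = f x := rfl

@[ext] theorem ext {f g : FiniteDual k R} (h : ∀ x, f x = g x) : f = g :=
  Subtype.ext (WithConv.ext (LinearMap.ext h))

/-- Build an element of the finite dual. -/
def mk (f : R →ₗ[k] k) (hf : VanishesOnCofiniteIdeal k R f) : FiniteDual k R :=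
  ⟨WithConv.toConv f, hf⟩

@[simp] theorem mk_apply (f : R →ₗ[k] k) (hf : VanishesOnCofiniteIdeal k R f) (x : R) :
    mk f hf x = f x := rfl

theorem ev_separates (f : FiniteDual k R) (h : ∀ x, ev x f = 0) : f = 0 := ext h

theorem one_apply (x : R) : (1 : FiniteDual k R) x = counit (R := k) x := rfl

theorem mul_apply (f g : FiniteDual k R) (x : R) :
    (f * g) x = LinearMap.mul' k k (TensorProduct.map f.toLin g.toLin (comul x)) := rfl

/-- Elements of `R° ⊗ R°` are determined by their values on `R × R`. -/
theorem tensor_ext {s t : FiniteDual k R ⊗[k] FiniteDual k R}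
    (h : ∀ x y, formMul (ev x) (ev y) s = formMul (ev x) (ev y) t) : s = t :=
  eq_of_formMul_eq ev ev ev_separates ev_separates h

theorem exists_comul (f : FiniteDual k R) :
    ∃ t : FiniteDual k R ⊗[k] FiniteDual k R, ∀ x y, formMul (ev x) (ev y) t = f (x * y) := by
  obtain ⟨A, _, _, _, φ, g, hg⟩ := VanishesOnCofiniteIdeal.exists_algHom f.2
  let ρ : Module.Dual k A →ₗ[k] FiniteDual k R :=
    { toFun l := mk (l ∘ₗ φ.toLinearMap) (.of_algHom φ _ fun x hx => by simp [hx])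
      map_add' _ _ := rfl
      map_smul' _ _ := rfl }
  let T := (TensorProduct.dualDistribEquiv k A A).symm (g ∘ₗ LinearMap.mul' k A)
  refine ⟨TensorProduct.map ρ ρ T, fun x y => ?_⟩
  have key : ∀ t : Module.Dual k A ⊗[k] Module.Dual k A,
      formMul (ev x) (ev y) (TensorProduct.map ρ ρ t) =
        TensorProduct.dualDistribEquiv k A A t (φ x ⊗ₜ φ y) := by
    intro t
    induction t using TensorProduct.induction_on with
    | zero => simp
    | tmul a b =>
      rw [TensorProduct.map_tmul, formMul_tmul]
      exact (TensorProduct.dualDistrib_apply a b (φ x) (φ y)).symm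
    | add a b ha hb => simp only [map_add, ha, hb, LinearMap.add_apply]
  rw [key, LinearEquiv.apply_symm_apply, LinearMap.comp_apply, LinearMap.mul'_apply, ← map_mul]
  exact (hg _).symm

/-- The comultiplication of `R°` is dual to the multiplication of `R`. -/
noncomputable def comulLin : FiniteDual k R →ₗ[k] FiniteDual k R ⊗[k] FiniteDual k R where
  toFun f := (exists_comul f).choose
  map_add' f g := tensor_ext fun x y => by
    rw [map_add, (exists_comul _).choose_spec, (exists_comul _).choose_spec,
      (exists_comul _).choose_spec]
    rfl
  map_smul' c f := tensor_ext fun x y => by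
    rw [map_smul, (exists_comul _).choose_spec, (exists_comul _).choose_spec]
    rfl

theorem formMul_comulLin (f : FiniteDual k R) (x y : R) :
    formMul (ev x) (ev y) (comulLin f) = f (x * y) := (exists_comul f).choose_spec x y

theorem formMul_comp_comulLin (x y : R) :
    formMul (ev x) (ev y) ∘ₗ comulLin = ev (k := k) (x * y) :=
  LinearMap.ext fun f => formMul_comulLin f x y

theorem counit_aux (f : FiniteDual k R) (y : R) :
    formMul (ev 1) (ev y) (comulLin f) = f y := by rw [formMul_comulLin, one_mul]

noncomputable instance : Coalgebra k (FiniteDual k R) where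
  comul := comulLin
  counit := ev 1
  coassoc := by
    ext1 f
    refine eq_of_formMul_eq (κ := R × R) ev (fun p => formMul (ev p.1) (ev p.2)) ev_separates
      (fun w hw => tensor_ext fun x y => by simpa using hw (x, y)) fun x p => ?_
    simp only [LinearMap.comp_apply, LinearEquiv.coe_coe, formMul_assoc, LinearMap.rTensor,
      LinearMap.lTensor, formMul_map, formMul_comp_comulLin, LinearMap.comp_id, formMul_comulLin,
      mul_assoc]
  rTensor_counit_comp_comul := by
    ext1 f
    refine eq_of_formMul_eq (ι := Unit) (fun _ => LinearMap.id) ev (fun v hv => hv ()) ev_separates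
      fun _ y => ?_
    simp [LinearMap.rTensor, formMul_map, formMul_comulLin]
  lTensor_counit_comp_comul := by
    ext1 f
    refine eq_of_formMul_eq (κ := Unit) ev (fun _ => LinearMap.id) ev_separates (fun v hv => hv ())
      fun x _ => ?_
    simp [LinearMap.lTensor, formMul_map, formMul_comulLin]

theorem counit_apply (f : FiniteDual k R) : counit (R := k) f = f 1 := rfl

/-- The comultiplication of `R°` is characterised by `Δ(f)(x ⊗ y) = f(xy)`. -/
theorem formMul_comul (f : FiniteDual k R) (x y : R) :
    formMul (ev x) (ev y) (comul f) = f (x * y) := formMul_comulLin f x y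

/-- The linear form on `R ⊗ R` defined by an element of `R° ⊗ R°`. -/
noncomputable def pairing : FiniteDual k R ⊗[k] FiniteDual k R →ₗ[k] (R ⊗[k] R →ₗ[k] k) :=
  TensorProduct.dualDistrib k R R ∘ₗ TensorProduct.map
    { toFun := toLin, map_add' := fun _ _ => rfl, map_smul' := fun _ _ => rfl }
    { toFun := toLin, map_add' := fun _ _ => rfl, map_smul' := fun _ _ => rfl }

theorem pairing_tmul (f g : FiniteDual k R) (x y : R) :
    pairing (f ⊗ₜ g) (x ⊗ₜ y) = f x * g y := rfl

theorem pairing_apply (t : FiniteDual k R ⊗[k] FiniteDual k R) (x y : R) :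
    pairing t (x ⊗ₜ y) = formMul (ev x) (ev y) t := by
  induction t using TensorProduct.induction_on with
  | zero => simp
  | tmul a b => simp [pairing_tmul]
  | add a b ha hb => simp only [map_add, ha, hb, LinearMap.add_apply]

theorem pairing_comul (f : FiniteDual k R) :
    pairing (comul f) = f.toLin ∘ₗ LinearMap.mul' k R := by
  ext x y
  simp [pairing_apply, formMul_comul]

theorem mul_apply_repr (f g : FiniteDual k R) (x : R) {ι : Type*} (r : Coalgebra.Repr k x ι) :
    (f * g) x = ∑ i ∈ r.index, f (r.left i) * g (r.right i) := by
  rw [mul_apply, ← r.eq]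
  simp

theorem formMul_mul (s t : FiniteDual k R ⊗[k] FiniteDual k R) (x y : R) :
    formMul (ev x) (ev y) (s * t) =
      LinearMap.mul' k k (TensorProduct.map (pairing s) (pairing t) (comul (x ⊗ₜ[k] y))) := by
  induction s using TensorProduct.induction_on with
  | zero => simp
  | add a b ha hb =>
    simp only [map_add, add_mul, ha, hb, TensorProduct.map_add_left, LinearMap.add_apply]
  | tmul a b =>
    induction t using TensorProduct.induction_on with
    | zero => simp
    | add c d hc hd =>
      simp only [map_add, mul_add, hc, hd, TensorProduct.map_add_right, LinearMap.add_apply]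
    | tmul c d =>
      rw [Algebra.TensorProduct.tmul_mul_tmul, formMul_tmul, ev_apply, ev_apply,
        mul_apply_repr _ _ _ (ℛ k x), mul_apply_repr _ _ _ (ℛ k y),
        ← ((ℛ k x).tmul (ℛ k y)).eq, Finset.sum_mul_sum]
      simp only [map_sum, TensorProduct.map_tmul, LinearMap.mul'_apply]
      rw [← Finset.sum_product']
      refine Finset.sum_congr rfl fun i _ => ?_
      exact mul_mul_mul_comm _ _ _ _

noncomputable instance : Bialgebra k (FiniteDual k R) :=
  .mk' _ _ (by rw [counit_apply, one_apply, Bialgebra.counit_one])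
    (fun {f g} => by simp only [counit_apply, mul_apply, Bialgebra.comul_one,
      Algebra.TensorProduct.one_def, TensorProduct.map_tmul, LinearMap.mul'_apply])
    (tensor_ext fun x y => by
      rw [formMul_comul, one_apply, Bialgebra.counit_mul, Algebra.TensorProduct.one_def,
        formMul_tmul]
      rfl)
    (fun {f g} => tensor_ext fun x y => by
      rw [formMul_comul, formMul_mul, pairing_comul, pairing_comul, TensorProduct.map_comp,
        LinearMap.comp_apply, mul_apply]
      have := CoalgHomClass.map_comp_comul_apply (Bialgebra.mulCoalgHom k R) (x ⊗ₜ[k] y)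
      exact congrArg (fun z => LinearMap.mul' k k (TensorProduct.map f.toLin g.toLin z)) this.symm)

end Bialg

section Hopf
variable [HopfAlgebra k R]

/-- The antipode of `R°` is dual to the antipode of `R`. -/
noncomputable def antipodeLin : FiniteDual k R →ₗ[k] FiniteDual k R where
  toFun f := mk (f.toLin ∘ₗ HopfAlgebra.antipode k) (by
    obtain ⟨A, _, _, _, φ, g, hg⟩ := VanishesOnCofiniteIdeal.exists_algHom f.2
    refine .of_algHom ((AlgHom.op φ).comp (HopfAlgebra.antipodeAlgHomOp k R)) _ fun x hx => ?_
    have hx' : φ (HopfAlgebra.antipode k x) = 0 := MulOpposite.op_injective hx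
    exact (hg _).trans (by rw [hx', map_zero]))
  map_add' _ _ := rfl
  map_smul' _ _ := rfl

theorem antipodeLin_apply (f : FiniteDual k R) (x : R) :
    antipodeLin f x = f (HopfAlgebra.antipode k x) := rfl

theorem ev_mul' (x : R) {ι : Type*} (r : Coalgebra.Repr k x ι)
    (t : FiniteDual k R ⊗[k] FiniteDual k R) :
    ev x (LinearMap.mul' k (FiniteDual k R) t) =
      ∑ i ∈ r.index, formMul (ev (r.left i)) (ev (r.right i)) t := by
  induction t using TensorProduct.induction_on with
  | zero => simp only [map_zero, Finset.sum_const_zero]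
  | add a b ha hb => simp only [map_add, ha, hb, Finset.sum_add_distrib]
  | tmul a b => simp [mul_apply_repr _ _ _ r]

theorem unit_counit_apply (f : FiniteDual k R) (x : R) :
    f (algebraMap k R (counit (R := k) x)) =
      ((Algebra.linearMap k (FiniteDual k R) ∘ₗ counit) f) x := by
  rw [LinearMap.comp_apply, counit_apply, Algebra.linearMap_apply, Algebra.algebraMap_eq_smul_one,
    Algebra.algebraMap_eq_smul_one, map_smul, smul_eq_mul, mul_comm]
  rfl

noncomputable instance : HopfAlgebra k (FiniteDual k R) where
  antipode := antipodeLin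
  mul_antipode_rTensor_comul := by
    ext f x
    have h := ev_mul' x (ℛ k x) (LinearMap.rTensor _ antipodeLin (comul (R := k) f))
    have he : ∀ y : R, ev y ∘ₗ antipodeLin = ev (k := k) (HopfAlgebra.antipode k y) :=
      fun _ => rfl
    simp only [LinearMap.rTensor, formMul_map, LinearMap.comp_id, he, formMul_comul,
      ← map_sum, HopfAlgebra.sum_antipode_mul_eq_algebraMap_counit] at h
    exact h.trans (unit_counit_apply f x)
  mul_antipode_lTensor_comul := by
    ext f x
    have h := ev_mul' x (ℛ k x) (LinearMap.lTensor _ antipodeLin (comul (R := k) f))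
    have he : ∀ y : R, ev y ∘ₗ antipodeLin = ev (k := k) (HopfAlgebra.antipode k y) :=
      fun _ => rfl
    simp only [LinearMap.lTensor, formMul_map, LinearMap.comp_id, he, formMul_comul,
      ← map_sum, HopfAlgebra.sum_mul_antipode_eq_algebraMap_counit] at h
    exact h.trans (unit_counit_apply f x)

theorem antipode_apply (f : FiniteDual k R) (x : R) :
    HopfAlgebra.antipode k f x = f (HopfAlgebra.antipode k x) := rfl

end Hopf

/-- For cocommutative `R`, the dual `R°` is commutative. -/
noncomputable instance [Bialgebra k R] [IsCocomm k R] : CommRing (FiniteDual k R) where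
  mul_comm f g := Subtype.ext (mul_comm (G := WithConv (R →ₗ[k] k)) f.1 g.1)

section Map
variable {S : Type v} [Ring S]

/-- The transpose `S° → R°` of a morphism of bialgebras `R → S`. -/
noncomputable def map [Bialgebra k R] [Bialgebra k S] (π : R →ₐc[k] S) :
    FiniteDual k S →ₐc[k] FiniteDual k R :=
  let F : FiniteDual k S →ₗ[k] FiniteDual k R :=
    { toFun f := mk (f.toLin ∘ₗ (π : R →ₗ[k] S)) (by
        obtain ⟨A, _, _, _, φ, g, hg⟩ := VanishesOnCofiniteIdeal.exists_algHom f.2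
        refine .of_algHom (φ.comp (π : R →ₐ[k] S)) _ fun x hx => ?_
        exact (hg _).trans ((congrArg g hx).trans (map_zero g)))
      map_add' _ _ := rfl
      map_smul' _ _ := rfl }
  have hF : ∀ f x, F f x = f (π x) := fun _ _ => rfl
  .ofAlgHom (.ofLinearMap F
      (ext fun x => by
        rw [hF, one_apply, one_apply]; exact CoalgHomClass.counit_comp_apply π x)
      (fun f g => ext fun x => by
        rw [hF, mul_apply, mul_apply, ← CoalgHomClass.map_comp_comul_apply π x,
          ← LinearMap.comp_apply (TensorProduct.map _ _), ← TensorProduct.map_comp]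
        rfl))
    (AlgHom.ext fun f => by
      change F f 1 = f 1
      rw [hF, map_one])
    (AlgHom.ext fun f => tensor_ext fun x y => by
      change formMul (ev x) (ev y) (TensorProduct.map F F (comul f)) =
        formMul (ev x) (ev y) (comul (F f))
      have he : ∀ y : R, ev y ∘ₗ F = ev (k := k) (π y) := fun _ => rfl
      rw [formMul_map, he, he, formMul_comul, formMul_comul, hF, map_mul π])

@[simp] theorem map_apply [Bialgebra k R] [Bialgebra k S] (π : R →ₐc[k] S) (f : FiniteDual k S)
    (x : R) : map π f x = f (π x) := rfl

end Map

end FiniteDual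

section HopfSubalgebra

variable {k : Type u} [Field k] {A : Type v} [CommRing A] [HopfAlgebra k A]

/-- A subspace `W` of a commutative Hopf algebra `A` is a Hopf subalgebra if it contains `1` and is
stable under multiplication, comultiplication (`Δ(W) ⊆ W ⊗ W`) and antipode. -/
structure Submodule.IsHopfSubalgebra (W : Submodule k A) : Prop where
  one_mem : (1 : A) ∈ W
  mul_mem : ∀ a b, a ∈ W → b ∈ W → a * b ∈ W
  comul_mem : ∀ a ∈ W,
    comul (R := k) a ∈ LinearMap.range (TensorProduct.map W.subtype W.subtype)
  antipode_mem : ∀ a ∈ W, HopfAlgebra.antipode k a ∈ W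

namespace Submodule.IsHopfSubalgebra

variable {W : Submodule k A}

/-- The underlying algebra of a Hopf subalgebra. -/
def Carrier (h : W.IsHopfSubalgebra) : Type v := W.toSubalgebra h.one_mem h.mul_mem

variable (h : W.IsHopfSubalgebra)

noncomputable instance : CommRing h.Carrier :=
  inferInstanceAs (CommRing (W.toSubalgebra h.one_mem h.mul_mem))

noncomputable instance : Algebra k h.Carrier :=
  inferInstanceAs (Algebra k (W.toSubalgebra h.one_mem h.mul_mem))

/-- The inclusion, as a morphism of algebras. -/
noncomputable def val : h.Carrier →ₐ[k] A := (W.toSubalgebra h.one_mem h.mul_mem).val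

theorem val_injective : Function.Injective h.val := Subtype.val_injective

theorem map_val_injective :
    Function.Injective (Algebra.TensorProduct.map h.val h.val) :=
  TensorProduct.map_injective_of_flat_flat h.val.toLinearMap h.val.toLinearMap
    h.val_injective h.val_injective

theorem map_map_val_injective :
    Function.Injective (Algebra.TensorProduct.map h.val (Algebra.TensorProduct.map h.val h.val)) :=
  TensorProduct.map_injective_of_flat_flat h.val.toLinearMap
    (Algebra.TensorProduct.map h.val h.val).toLinearMap h.val_injective h.map_val_injective

theorem exists_comul (a : h.Carrier) :
    ∃ t, Algebra.TensorProduct.map h.val h.val t = comul (R := k) (h.val a) :=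
  h.comul_mem a.1 a.2

/-- The value of the restricted comultiplication. -/
noncomputable def comulFun (a : h.Carrier) : h.Carrier ⊗[k] h.Carrier := (h.exists_comul a).choose

theorem map_comulFun (a : h.Carrier) :
    Algebra.TensorProduct.map h.val h.val (h.comulFun a) = comul (R := k) (h.val a) :=
  (h.exists_comul a).choose_spec

/-- The restricted comultiplication. -/
noncomputable def comulAlgHom : h.Carrier →ₐ[k] h.Carrier ⊗[k] h.Carrier where
  toFun a := h.comulFun a
  map_one' := h.map_val_injective (by
    rw [map_comulFun, map_one h.val, Bialgebra.comul_one, map_one])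
  map_mul' a b := h.map_val_injective (by
    rw [map_mul, map_comulFun, map_comulFun, map_comulFun, map_mul, Bialgebra.comul_mul])
  map_zero' := h.map_val_injective (by rw [map_comulFun, map_zero, map_zero, map_zero])
  map_add' a b := h.map_val_injective (by
    rw [map_add, map_comulFun, map_comulFun, map_comulFun, map_add, map_add])
  commutes' c := h.map_val_injective (by
    rw [map_comulFun, AlgHom.commutes, AlgHom.commutes, Bialgebra.comul_algebraMap])

theorem map_comul (a : h.Carrier) :
    Algebra.TensorProduct.map h.val h.val (h.comulAlgHom a) = comul (R := k) (h.val a) :=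
  h.map_comulFun a

theorem map_comp_comul :
    (Algebra.TensorProduct.map h.val h.val).comp h.comulAlgHom =
      (Bialgebra.comulAlgHom k A).comp h.val := AlgHom.ext h.map_comul

theorem map_assoc (t : (h.Carrier ⊗[k] h.Carrier) ⊗[k] h.Carrier) :
    Algebra.TensorProduct.map h.val (Algebra.TensorProduct.map h.val h.val)
        (Algebra.TensorProduct.assoc k k k h.Carrier h.Carrier h.Carrier t) =
      Algebra.TensorProduct.assoc k k k A A A
        (Algebra.TensorProduct.map (Algebra.TensorProduct.map h.val h.val) h.val t) := by
  induction t using TensorProduct.induction_on with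
  | zero => simp only [map_zero]
  | add a b ha hb => simp only [map_add, ha, hb]
  | tmul s c =>
    induction s using TensorProduct.induction_on with
    | zero => simp only [map_zero, TensorProduct.zero_tmul]
    | add a b ha hb => simp only [map_add, TensorProduct.add_tmul, ha, hb]
    | tmul a b => rfl

theorem map_comul_left (t : h.Carrier ⊗[k] h.Carrier) :
    Algebra.TensorProduct.map (Algebra.TensorProduct.map h.val h.val) h.val
        (Algebra.TensorProduct.map h.comulAlgHom (.id k h.Carrier) t) =
      Algebra.TensorProduct.map (Bialgebra.comulAlgHom k A) (.id k A)
        (Algebra.TensorProduct.map h.val h.val t) := by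
  induction t using TensorProduct.induction_on with
  | zero => simp only [map_zero]
  | add a b ha hb => simp only [map_add, ha, hb]
  | tmul a b =>
    simp only [Algebra.TensorProduct.map_tmul, map_comul]
    rfl

theorem map_comul_right (t : h.Carrier ⊗[k] h.Carrier) :
    Algebra.TensorProduct.map h.val (Algebra.TensorProduct.map h.val h.val)
        (Algebra.TensorProduct.map (.id k h.Carrier) h.comulAlgHom t) =
      Algebra.TensorProduct.map (.id k A) (Bialgebra.comulAlgHom k A)
        (Algebra.TensorProduct.map h.val h.val t) := by
  induction t using TensorProduct.induction_on with
  | zero => simp only [map_zero]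
  | add a b ha hb => simp only [map_add, ha, hb]
  | tmul a b =>
    simp only [Algebra.TensorProduct.map_tmul, map_comul]
    rfl

noncomputable instance : Bialgebra k h.Carrier :=
  .ofAlgHom h.comulAlgHom ((Bialgebra.counitAlgHom k A).comp h.val)
    (AlgHom.ext fun a => h.map_map_val_injective <|
      (h.map_assoc _).trans <| (congrArg _ (h.map_comul_left _)).trans <| by
        refine Eq.trans ?_ (h.map_comul_right _).symm
        simp only [RingHom.coe_coe, map_comul]
        exact Coalgebra.coassoc_apply (R := k) (h.val a))
    (AlgHom.ext fun a => by
      apply (TensorProduct.map_injective_of_flat_flat (LinearMap.id (R := k) (M := k))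
        h.val.toLinearMap Function.injective_id h.val_injective)
      have key : ∀ t : h.Carrier ⊗[k] h.Carrier,
          TensorProduct.map (LinearMap.id (R := k) (M := k)) h.val.toLinearMap
            (Algebra.TensorProduct.map ((Bialgebra.counitAlgHom k A).comp h.val)
              (.id k h.Carrier) t) =
          LinearMap.rTensor A (counit (R := k) (A := A))
            (Algebra.TensorProduct.map h.val h.val t) := by
        intro t
        induction t using TensorProduct.induction_on with
        | zero => simp only [map_zero]
        | add a b ha hb => simp only [map_add, ha, hb]
        | tmul a b => rfl
      refine (key _).trans ((congrArg _ (h.map_comul a)).trans ?_)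
      exact Coalgebra.rTensor_counit_comul (R := k) (h.val a))
    (AlgHom.ext fun a => by
      apply (TensorProduct.map_injective_of_flat_flat h.val.toLinearMap
        (LinearMap.id (R := k) (M := k)) h.val_injective Function.injective_id)
      have key : ∀ t : h.Carrier ⊗[k] h.Carrier,
          TensorProduct.map h.val.toLinearMap (LinearMap.id (R := k) (M := k))
            (Algebra.TensorProduct.map (.id k h.Carrier)
              ((Bialgebra.counitAlgHom k A).comp h.val) t) =
          LinearMap.lTensor A (counit (R := k) (A := A))
            (Algebra.TensorProduct.map h.val h.val t) := by
        intro t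
        induction t using TensorProduct.induction_on with
        | zero => simp only [map_zero]
        | add a b ha hb => simp only [map_add, ha, hb]
        | tmul a b => rfl
      refine (key _).trans ((congrArg _ (h.map_comul a)).trans ?_)
      exact Coalgebra.lTensor_counit_comul (R := k) (h.val a))

/-- The restricted antipode. -/
noncomputable def antipodeLin : h.Carrier →ₗ[k] h.Carrier :=
  (HopfAlgebra.antipode k ∘ₗ h.val.toLinearMap).codRestrict W fun a => h.antipode_mem _ a.2

theorem val_antipodeLin (a : h.Carrier) :
    h.val (h.antipodeLin a) = HopfAlgebra.antipode k (h.val a) := rfl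

noncomputable instance : HopfAlgebra k h.Carrier where
  antipode := h.antipodeLin
  mul_antipode_rTensor_comul := by
    ext a
    apply h.val_injective
    have key : ∀ t : h.Carrier ⊗[k] h.Carrier,
        h.val (LinearMap.mul' k _ (LinearMap.rTensor _ h.antipodeLin t)) =
          LinearMap.mul' k A (LinearMap.rTensor _ (HopfAlgebra.antipode k)
            (Algebra.TensorProduct.map h.val h.val t)) := by
      intro t
      induction t using TensorProduct.induction_on with
      | zero => simp only [map_zero]
      | add a b ha hb => simp only [map_add, ha, hb]
      | tmul a b => exact map_mul h.val _ _
    refine (key _).trans ((congrArg _ (congrArg _ (h.map_comul a))).trans ?_)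
    refine (HopfAlgebra.mul_antipode_rTensor_comul_apply (R := k) (h.val a)).trans ?_
    exact (h.val.commutes _).symm
  mul_antipode_lTensor_comul := by
    ext a
    apply h.val_injective
    have key : ∀ t : h.Carrier ⊗[k] h.Carrier,
        h.val (LinearMap.mul' k _ (LinearMap.lTensor _ h.antipodeLin t)) =
          LinearMap.mul' k A (LinearMap.lTensor _ (HopfAlgebra.antipode k)
            (Algebra.TensorProduct.map h.val h.val t)) := by
      intro t
      induction t using TensorProduct.induction_on with
      | zero => simp only [map_zero]
      | add a b ha hb => simp only [map_add, ha, hb]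
      | tmul a b => exact map_mul h.val _ _
    refine (key _).trans ((congrArg _ (congrArg _ (h.map_comul a))).trans ?_)
    refine (HopfAlgebra.mul_antipode_lTensor_comul_apply (R := k) (h.val a)).trans ?_
    exact (h.val.commutes _).symm

/-- The inclusion of a Hopf subalgebra, as a morphism of Hopf algebras. -/
noncomputable def incl : h.Carrier →ₐc[k] A :=
  .ofAlgHom h.val rfl h.map_comp_comul

end Submodule.IsHopfSubalgebra

end HopfSubalgebra

section RelatedHopfAlgebras

variable (k : Type u) [Field k] (R : Type v) [Ring R]

/-- The augmentation ideal of a bialgebra, i.e. the kernel of the counit. -/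
noncomputable def augmentationIdeal [Bialgebra k R] : Ideal R :=
  RingHom.ker (Bialgebra.counitAlgHom k R)

/-- `R†`: the subspace of those elements of `R°` vanishing on some power of the augmentation
ideal. -/
noncomputable def unipotentDual [HopfAlgebra k R] : Submodule k (FiniteDual k R) where
  carrier := {f | ∃ n : ℕ, 1 ≤ n ∧ ∀ x ∈ augmentationIdeal k R ^ n, f x = 0}
  zero_mem' := ⟨1, le_rfl, fun _ _ => rfl⟩
  add_mem' := by
    rintro f g ⟨n, hn, hf⟩ ⟨m, hm, hg⟩
    refine ⟨n + m, by omega, fun x hx => ?_⟩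
    have h1 := hf x (Ideal.pow_le_pow_right (Nat.le_add_right n m) hx)
    have h2 := hg x (Ideal.pow_le_pow_right (Nat.le_add_left m n) hx)
    change f x + g x = 0
    rw [h1, h2, add_zero]
  smul_mem' := by
    rintro c f ⟨n, hn, hf⟩
    refine ⟨n, hn, fun x hx => ?_⟩
    change c * f x = 0
    rw [hf x hx, mul_zero]

/-- The two-sided ideal of `R` generated by all commutators `xy - yx`. -/
def commutatorIdeal : TwoSidedIdeal R :=
  TwoSidedIdeal.span {z | ∃ x y : R, z = x * y - y * x}

/-- The ring `R^ab`, the quotient of `R` by the two-sided ideal generated by the commutators. -/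
def RingAb : Type v := R ⧸ (commutatorIdeal R).asIdeal

namespace RingAb

instance : Ring (RingAb R) := inferInstanceAs (Ring (R ⧸ (commutatorIdeal R).asIdeal))

/-- The algebra structure of `R^ab`. It is not a global instance, so that a Hopf algebra structure
on `R^ab`, which contains an algebra structure, can be quantified over. -/
@[reducible]
def algebra [Algebra k R] : Algebra k (RingAb R) :=
  inferInstanceAs (Algebra k (R ⧸ (commutatorIdeal R).asIdeal))

/-- The projection `R → R^ab`. -/
def proj : R →+* RingAb R := Ideal.Quotient.mk (commutatorIdeal R).asIdeal

end RingAb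

/-- The map `f` between (the underlying rings of) Hopf algebras is a morphism of Hopf algebras. -/
def IsHopfHom {A : Type*} {B : Type*} [Ring A] [Ring B] (hA : HopfAlgebra k A)
    (hB : HopfAlgebra k B) (f : A → B) : Prop :=
  ∃ φ : A →ₐc[k] B, ∀ x, φ x = f x

end RelatedHopfAlgebras

section GroupSchemes

variable {k : Type u} [Field k]

/-- The affine group scheme `Spec A` over `k` defined by a commutative Hopf algebra `A`. -/
noncomputable abbrev specGrp (k : Type u) [Field k] (A : Type u) [CommRing A] [HopfAlgebra k A] :
    Grp (Over (Spec (CommRingCat.of k))) :=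
  (hopfSpec (CommRingCat.of k)).obj (.op (CommHopfAlgCat.of k A))

/-- The morphism `Spec B ⟶ Spec A` of group schemes defined by a morphism `A → B` of Hopf
algebras. -/
noncomputable abbrev specGrpMap {A B : Type u} [CommRing A] [HopfAlgebra k A] [CommRing B]
    [HopfAlgebra k B] (f : A →ₐc[k] B) : specGrp k B ⟶ specGrp k A :=
  (hopfSpec (CommRingCat.of k)).map (CommHopfAlgCat.ofHom (R := k) f).op

/-- `G` is an abelian group scheme. -/
def IsAbelianGrpSch (G : Grp (Over (Spec (CommRingCat.of k)))) : Prop := IsCommMonObj G.X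

/-- `ρ : V → V ⊗ A` is a (right) coaction. -/
structure IsCoaction {A V : Type*} [AddCommGroup A] [Module k A] [Coalgebra k A]
    [AddCommGroup V] [Module k V] (ρ : V →ₗ[k] V ⊗[k] A) : Prop where
  coassoc : (TensorProduct.assoc k V A A).toLinearMap ∘ₗ ρ.rTensor A ∘ₗ ρ = comul.lTensor V ∘ₗ ρ
  counit : (TensorProduct.rid k V).toLinearMap ∘ₗ counit.lTensor V ∘ₗ ρ = LinearMap.id

/-- `G` is a unipotent affine group scheme: it is of the form `Spec A`, and each nonzero
representation of it, i.e. each nonzero right `A`-comodule, has a nonzero fixed vector. -/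
def IsUnipotentGrpSch (G : Grp (Over (Spec (CommRingCat.of k)))) : Prop :=
  ∃ (A : Type u) (_ : CommRing A) (_ : HopfAlgebra k A), Nonempty (G ≅ specGrp k A) ∧
    ∀ (V : Type u) [AddCommGroup V] [Module k V] [Nontrivial V] (ρ : V →ₗ[k] V ⊗[k] A),
      IsCoaction ρ → ∃ v : V, v ≠ 0 ∧ ρ v = v ⊗ₜ 1

/-- A morphism `G ⟶ Q` of affine group schemes over a field is a quotient map if the map
`O(Q) → O(G)` on rings of functions is injective. -/
def IsQuotientGrpSch {G Q : Grp (Over (Spec (CommRingCat.of k)))} (q : G ⟶ Q) : Prop :=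
  Function.Injective q.hom.hom.left.appTop

/-- For a class `P` of group schemes, `q : G ⟶ Q` is the largest quotient of `G` in `P`: it is a
quotient map of affine group schemes, `Q` is in `P`, and each morphism from `G` to an affine group
scheme in `P` factors uniquely through `q`. -/
structure IsLargestQuotient (P : Grp (Over (Spec (CommRingCat.of k))) → Prop)
    {G Q : Grp (Over (Spec (CommRingCat.of k)))} (q : G ⟶ Q) : Prop where
  isAffine : IsAffine Q.X.left
  mem : P Q
  isQuotientMap : IsQuotientGrpSch q
  existsUnique_fac : ∀ H : Grp (Over (Spec (CommRingCat.of k))), IsAffine H.X.left → P H →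
    ∀ f : G ⟶ H, ∃! g : Q ⟶ H, q ≫ g = f

end GroupSchemes

/-! ### Affine group schemes and commutative Hopf algebras -/

section GroupSchemeLemmas

open MonoidalCategory MonObj Opposite

/-! Affine group schemes over `k` are anti-equivalent to commutative Hopf algebras. An injection `A
→ B` is therefore the largest quotient of `Spec B` in a class as soon as `Spec A` is in the class
and each morphism `C → B`, with `Spec C` in the class, has its image in `A`; uniqueness is automatic
(`isLargestQuotient_specGrpMap`). All else rests on the rule `Δ(f)(x ⊗ y) = f(xy)` in `R°`.

Abelian quotient. The commutators generate a Hopf ideal, and `(R^ab)°` is the set of forms in `R°`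
that vanish on it. If `C` is cocommutative and `φ : C → R°`, the symmetry of `Δ(c)` gives `φ(c)(xy)
= φ(c)(yx)`, and this spreads to the whole ideal
(`FiniteDual.apply_eq_zero_of_mem_commutatorIdeal`).

Unipotent quotient. `R†` is closed under products because `Δ(𝔞) ⊆ 𝔞 ⊗ R + 1 ⊗ 𝔞`
(`formMul_comul_eq_zero_of_mem_pow`). On an `R†`-comodule `R` acts so that each vector is killed by
a power of `𝔞`; the last nonzero stage consists of fixed vectors
(`exists_fixed_of_isCoaction_unipotentDual`). Conversely, let `B` be the Hopf algebra of a unipotent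
group, `φ : B → R°`, and `W` the largest subcomodule of `B` inside `φ⁻¹(R†)`. A fixed vector of
`B/W` lifts to `b` with `Δ(b) - b ⊗ 1 ∈ W ⊗ B`, which forces `φ(b)` to vanish on some `𝔞^(n+1)`; so
`W` could be enlarged unless `W = B` (`eq_top_of_forall_exists_fixed`,
`mem_unipotentDual_of_forall_exists_fixed`). -/

/-- The commutativity of a monoid object is invariant under isomorphism. -/
theorem CategoryTheory.IsCommMonObj.of_iso {C : Type*} [Category C] [MonoidalCategory C]
    [BraidedCategory C] {M N : C} [MonObj M] [MonObj N] (e : M ≅ N) [IsMonHom e.hom] [IsCommMonObj M] :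
    IsCommMonObj N where
  mul_comm := by
    rw [← cancel_epi (e.hom ⊗ₘ e.hom), ← IsMonHom.mul_hom e.hom,
      BraidedCategory.braiding_naturality_assoc, ← IsMonHom.mul_hom e.hom,
      IsCommMonObj.mul_comm_assoc]

/-- A faithful braided functor reflects commutativity of monoid objects. -/
theorem CategoryTheory.IsCommMonObj.of_map {C D : Type*} [Category C] [MonoidalCategory C] [BraidedCategory C]
    [Category D] [MonoidalCategory D] [BraidedCategory D] (F : C ⥤ D) [F.Braided] [F.Faithful]
    (M : C) [MonObj M] (h : @IsCommMonObj D _ _ _ (F.obj M) (F.monObjObj M)) : IsCommMonObj M where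
  mul_comm := by
    apply F.map_injective
    rw [← cancel_epi (Functor.LaxMonoidal.μ F M M), Functor.map_comp,
      Functor.LaxBraided.braided_assoc]
    exact h.mul_comm

variable {k : Type u} [Field k]

/-- The morphism of schemes underlying `specGrpMap f`. -/
theorem specGrpMap_left {A B : Type u} [CommRing A] [HopfAlgebra k A] [CommRing B]
    [HopfAlgebra k B] (f : A →ₐc[k] B) :
    (specGrpMap f).hom.hom.left =
      Spec.map (CommRingCat.ofHom ((f : A →ₐ[k] B) : A →+* B)) := rfl

theorem specGrpMap_surjective {A B : Type u} [CommRing A] [HopfAlgebra k A] [CommRing B]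
    [HopfAlgebra k B] (g : specGrp k B ⟶ specGrp k A) : ∃ φ : A →ₐc[k] B, specGrpMap φ = g := by
  have : (hopfSpec (CommRingCat.of k)).Full := hopfSpec.instFull
  obtain ⟨f, rfl⟩ := (hopfSpec (CommRingCat.of k)).map_surjective g
  exact ⟨f.unop.hom, rfl⟩

theorem specGrpMap_injective {A B : Type u} [CommRing A] [HopfAlgebra k A] [CommRing B]
    [HopfAlgebra k B] {φ ψ : A →ₐc[k] B} (h : specGrpMap φ = specGrpMap ψ) : φ = ψ :=
  have : (hopfSpec (CommRingCat.of k)).Faithful := hopfSpec.instFaithful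
  congrArg (fun f => f.unop.hom) ((hopfSpec (CommRingCat.of k)).map_injective h)

theorem specGrpMap_comp {A B C : Type u} [CommRing A] [HopfAlgebra k A] [CommRing B]
    [HopfAlgebra k B] [CommRing C] [HopfAlgebra k C] (i : A →ₐc[k] B) (ψ : C →ₐc[k] A) :
    specGrpMap (i.comp ψ) = specGrpMap i ≫ specGrpMap ψ :=
  (hopfSpec (CommRingCat.of k)).map_comp
    (CommHopfAlgCat.ofHom (R := k) i).op (CommHopfAlgCat.ofHom (R := k) ψ).op

theorem isQuotientGrpSch_specGrpMap {A B : Type u} [CommRing A] [HopfAlgebra k A] [CommRing B]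
    [HopfAlgebra k B] (f : A →ₐc[k] B) (hf : Function.Injective f) :
    IsQuotientGrpSch (specGrpMap f) := by
  unfold IsQuotientGrpSch
  rw [specGrpMap_left]
  have h := Scheme.ΓSpecIso_naturality (CommRingCat.ofHom ((f : A →ₐ[k] B) : A →+* B))
  rw [← Iso.eq_comp_inv] at h
  have h2 : Function.Injective (Scheme.Hom.appTop (Spec.map
      (CommRingCat.ofHom ((f : A →ₐ[k] B) : A →+* B)))).hom := by
    rw [h]
    simp only [CommRingCat.hom_comp, RingHom.coe_comp]
    exact (ConcreteCategory.bijective_of_isIso (Scheme.ΓSpecIso (CommRingCat.of B)).inv).1.comp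
      (hf.comp (ConcreteCategory.bijective_of_isIso (Scheme.ΓSpecIso (CommRingCat.of A)).hom).1)
  exact h2

theorem isAffine_specGrp (A : Type u) [CommRing A] [HopfAlgebra k A] :
    IsAffine (specGrp k A).X.left :=
  essImage_hopfSpec.mp ((hopfSpec _).obj_mem_essImage _)

theorem exists_iso_specGrp (G : Grp (Over (Spec (CommRingCat.of k)))) (hG : IsAffine G.X.left) :
    ∃ (A : Type u) (_ : CommRing A) (_ : HopfAlgebra k A), Nonempty (G ≅ specGrp k A) := by
  obtain ⟨A, ⟨e⟩⟩ := essImage_hopfSpec.mpr hG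
  exact ⟨A.unop, inferInstance, inferInstance, ⟨e.symm⟩⟩

theorem IsAbelianGrpSch.of_iso {G H : Grp (Over (Spec (CommRingCat.of k)))} (e : G ≅ H)
    (h : IsAbelianGrpSch G) : IsAbelianGrpSch H := by
  have : IsCommMonObj G.X := h
  let e' : G.X ≅ H.X := (Grp.forget _).mapIso e
  have : IsMonHom e'.hom := inferInstanceAs (IsMonHom e.hom.hom.hom)
  exact IsCommMonObj.of_iso e'

/-- The multiplication of `Spec A` is dual to `Δ` and the braiding to the swap. Since `algSpec` is
braided and faithful, commutativity can be read off in the opposite category of commutative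
algebras. -/
theorem isAbelianGrpSch_specGrp_iff (A : Type u) [CommRing A] [HopfAlgebra k A] :
    IsAbelianGrpSch (specGrp k A) ↔ IsCocomm k A := by
  constructor
  · intro h
    have : (algSpec (CommRingCat.of k)).Faithful := algSpec.instFaithful
    have h1 : IsCommMonObj (op (CommAlgCat.of k A)) :=
      @IsCommMonObj.of_map _ _ _ _ _ _ _ _ (algSpec (CommRingCat.of k)) braidedAlgSpec _
        (op (CommAlgCat.of k A)) _ h
    constructor
    ext x
    exact congr(($(h1.mul_comm)).unop.hom x)
  · intro h
    exact isCommMonObj_spec_asOver_spec (R := CommRingCat.of k) (A := CommRingCat.of A)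

/-- A morphism of bialgebras whose range is contained in that of an injective morphism factors
through it. -/
theorem BialgHom.exists_fac {A B C : Type*} [Ring A] [Bialgebra k A] [Ring B]
    [Bialgebra k B] [Ring C] [Bialgebra k C] (i : A →ₐc[k] B) (hi : Function.Injective i)
    (φ : C →ₐc[k] B) (h : ∀ c, ∃ a, i a = φ c) : ∃ ψ : C →ₐc[k] A, i.comp ψ = φ := by
  choose g hg using h
  let ψ : C →ₐ[k] A :=
    { toFun := g
      map_one' := hi (by rw [hg, map_one, map_one])
      map_mul' := fun a b => hi (by rw [hg, map_mul, map_mul, hg, hg])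
      map_zero' := hi (by rw [hg, map_zero, map_zero])
      map_add' := fun a b => hi (by rw [hg, map_add, map_add, hg, hg])
      commutes' := fun c => hi (by rw [hg, AlgHomClass.commutes, AlgHomClass.commutes]) }
  have hψ : ∀ c, i (ψ c) = φ c := hg
  refine ⟨.ofAlgHom ψ (AlgHom.ext fun c => ?_) (AlgHom.ext fun c => ?_), ?_⟩
  · change counit (R := k) (ψ c) = counit (R := k) c
    rw [← CoalgHomClass.counit_comp_apply i, hψ, CoalgHomClass.counit_comp_apply φ]
  · change TensorProduct.map ψ.toLinearMap ψ.toLinearMap (comul (R := k) c) = comul (ψ c)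
    -- Over a field `i ⊗ i` is again injective, so compatibility with `Δ` can be tested in `B ⊗ B`,
    -- where it is that of `φ`.
    apply TensorProduct.map_injective_of_flat_flat (i : A →ₗ[k] B) (i : A →ₗ[k] B) hi hi
    rw [← LinearMap.comp_apply, ← TensorProduct.map_comp]
    have : (i : A →ₗ[k] B) ∘ₗ ψ.toLinearMap = (φ : C →ₗ[k] B) := LinearMap.ext hψ
    rw [this]
    refine (CoalgHomClass.map_comp_comul_apply φ c).trans ?_
    refine Eq.trans ?_ (CoalgHomClass.map_comp_comul_apply i (ψ c)).symm
    rw [hψ]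
  · ext c
    exact hψ c

/-- Criterion for an injective morphism of Hopf algebras to define the largest quotient of a group
scheme in a class `P`. -/
theorem isLargestQuotient_specGrpMap (P : Grp (Over (Spec (CommRingCat.of k))) → Prop)
    {A B : Type u} [CommRing A] [HopfAlgebra k A] [CommRing B] [HopfAlgebra k B] (i : A →ₐc[k] B)
    (hi : Function.Injective i) (hA : P (specGrp k A))
    (hP : ∀ H : Grp (Over (Spec (CommRingCat.of k))), IsAffine H.X.left → P H →
      ∃ (C : Type u) (_ : CommRing C) (_ : HopfAlgebra k C), Nonempty (H ≅ specGrp k C) ∧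
        ∀ (φ : C →ₐc[k] B) (c : C), ∃ a, i a = φ c) :
    IsLargestQuotient P (specGrpMap i) where
  isAffine := isAffine_specGrp A
  mem := hA
  isQuotientMap := isQuotientGrpSch_specGrpMap i hi
  existsUnique_fac H hH hPH f := by
    obtain ⟨C, _, _, ⟨e⟩, hC⟩ := hP H hH hPH
    obtain ⟨φ, hφ⟩ := specGrpMap_surjective (f ≫ e.hom)
    obtain ⟨ψ, hψ⟩ := BialgHom.exists_fac i hi φ (hC φ)
    refine ⟨specGrpMap ψ ≫ e.inv, ?_, fun g hg => ?_⟩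
    · change specGrpMap i ≫ specGrpMap ψ ≫ e.inv = f
      rw [← Category.assoc, ← specGrpMap_comp, hψ, hφ, Category.assoc, e.hom_inv_id, Category.comp_id]
    · obtain ⟨ψ', hψ'⟩ := specGrpMap_surjective (g ≫ e.hom)
      have h1 : specGrpMap (i.comp ψ') = specGrpMap φ := by
        rw [specGrpMap_comp, hψ', ← Category.assoc, hg, hφ]
      have h2 : i.comp ψ' = φ := specGrpMap_injective h1
      have h3 : ψ' = ψ := by
        ext c
        exact hi (DFunLike.congr_fun (h2.trans hψ.symm) c)
      rw [Iso.eq_comp_inv, ← h3, hψ']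

end GroupSchemeLemmas

/-! ### The Hopf algebra `R^ab` and the largest abelian quotient -/

section CommutatorQuotient

variable {k : Type u} [Field k]

theorem commutatorIdeal_map_eq_zero {R S : Type*} [Ring R] [Ring S] (F : R →+* S)
    (h : ∀ x y, F x * F y = F y * F x) {x : R} (hx : x ∈ commutatorIdeal R) : F x = 0 := by
  have hle : commutatorIdeal R ≤ TwoSidedIdeal.ker F := by
    refine TwoSidedIdeal.span_le.mpr ?_
    rintro _ ⟨x, y, rfl⟩
    change x * y - y * x ∈ TwoSidedIdeal.ker F
    rw [TwoSidedIdeal.mem_ker, map_sub, map_mul, map_mul, h, sub_self]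
  exact (TwoSidedIdeal.mem_ker _).mp (hle hx)

/-- Commutativity is a hypothesis here, not an instance, because `RingAb R` carries only a `Ring`
structure. -/
theorem TensorProduct.mul_comm_of_mul_comm {A : Type*} [Ring A] [Algebra k A]
    (h : ∀ a b : A, a * b = b * a) (s t : A ⊗[k] A) : s * t = t * s := by
  induction s using TensorProduct.induction_on with
  | zero => rw [zero_mul, mul_zero]
  | add a b ha hb => rw [add_mul, mul_add, ha, hb]
  | tmul a b =>
    induction t using TensorProduct.induction_on with
    | zero => rw [zero_mul, mul_zero]
    | add c d hc hd => rw [add_mul, mul_add, hc, hd]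
    | tmul c d =>
      rw [Algebra.TensorProduct.tmul_mul_tmul, Algebra.TensorProduct.tmul_mul_tmul, h a, h b]

theorem TensorProduct.formMul_comm {V W : Type*} [AddCommGroup V] [Module k V]
    [AddCommGroup W] [Module k W] (e : V →ₗ[k] k) (e' : W →ₗ[k] k) (t : V ⊗[k] W) :
    formMul e' e (TensorProduct.comm k V W t) = formMul e e' t := by
  induction t using TensorProduct.induction_on with
  | zero => simp only [map_zero]
  | add a b ha hb => simp only [map_add, ha, hb]
  | tmul a b => rw [TensorProduct.comm_tmul, formMul_tmul, formMul_tmul, mul_comm]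

theorem TensorProduct.formMul_zero_left {V W : Type*} [AddCommGroup V] [Module k V]
    [AddCommGroup W] [Module k W] (e' : W →ₗ[k] k) (t : V ⊗[k] W) :
    formMul (0 : V →ₗ[k] k) e' t = 0 := by
  rw [formMul, TensorProduct.map_zero_left, LinearMap.comp_zero, LinearMap.zero_apply]

theorem TensorProduct.formMul_zero_right {V W : Type*} [AddCommGroup V] [Module k V]
    [AddCommGroup W] [Module k W] (e : V →ₗ[k] k) (t : V ⊗[k] W) :
    formMul e (0 : W →ₗ[k] k) t = 0 := by
  rw [formMul, TensorProduct.map_zero_right, LinearMap.comp_zero, LinearMap.zero_apply]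

theorem RingAb.proj_surjective (R : Type v) [Ring R] : Function.Surjective (RingAb.proj R) :=
  Ideal.Quotient.mk_surjective

theorem RingAb.proj_eq_zero_iff {R : Type v} [Ring R] {x : R} :
    RingAb.proj R x = 0 ↔ x ∈ commutatorIdeal R :=
  Ideal.Quotient.eq_zero_iff_mem.trans TwoSidedIdeal.mem_asIdeal

theorem RingAb.mul_comm {R : Type v} [Ring R] (a b : RingAb R) : a * b = b * a := by
  obtain ⟨x, rfl⟩ := RingAb.proj_surjective R a
  obtain ⟨y, rfl⟩ := RingAb.proj_surjective R b
  rw [← sub_eq_zero, ← map_mul, ← map_mul, ← map_sub, RingAb.proj_eq_zero_iff]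
  exact TwoSidedIdeal.subset_span ⟨x, y, rfl⟩

/-- The counit and `(q ⊗ q) ∘ Δ` are ring maps whose targets are commutative, so they kill
commutators. The antipode reverses products: it sends commutators to commutators and exchanges left
and right absorption. -/
instance commutatorIdeal_isHopfIdeal (R : Type v) [Ring R] [HopfAlgebra k R] :
    (commutatorIdeal R).asIdeal.IsHopfIdeal k where
  counit_eq_zero x hx :=
    commutatorIdeal_map_eq_zero ((Bialgebra.counitAlgHom k R : R →ₐ[k] k) : R →+* k)
      (fun _ _ => mul_comm _ _) (TwoSidedIdeal.mem_asIdeal.mp hx)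
  map_mkQ_comul_eq_zero x hx := by
    let q := Ideal.Quotient.mkₐ k (commutatorIdeal R).asIdeal
    let F := (Algebra.TensorProduct.map q q).comp (Bialgebra.comulAlgHom k R)
    have hq : ∀ a b : R ⧸ (commutatorIdeal R).asIdeal, a * b = b * a := RingAb.mul_comm (R := R)
    exact commutatorIdeal_map_eq_zero F.toRingHom
      (fun _ _ => TensorProduct.mul_comm_of_mul_comm hq _ _) (TwoSidedIdeal.mem_asIdeal.mp hx)
  antipode_mem x hx := by
    rw [TwoSidedIdeal.mem_asIdeal] at hx ⊢
    induction hx using TwoSidedIdeal.span_induction with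
    | mem x h =>
      obtain ⟨x, y, rfl⟩ := h
      rw [map_sub, HopfAlgebra.antipode_mul_antidistrib, HopfAlgebra.antipode_mul_antidistrib]
      exact TwoSidedIdeal.subset_span ⟨_, _, rfl⟩
    | zero => rw [map_zero]; exact TwoSidedIdeal.zero_mem _
    | add x y _ _ hx hy => rw [map_add]; exact TwoSidedIdeal.add_mem _ hx hy
    | neg x _ hx => rw [map_neg]; exact TwoSidedIdeal.neg_mem _ hx
    | left_absorb a x _ hx =>
      rw [HopfAlgebra.antipode_mul_antidistrib]; exact TwoSidedIdeal.mul_mem_right _ _ _ hx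
    | right_absorb a x _ hx =>
      rw [HopfAlgebra.antipode_mul_antidistrib]; exact TwoSidedIdeal.mul_mem_left _ _ _ hx

open WithConv in
/-- There is at most one Hopf algebra structure on an algebra `B` for which a given surjective map
to `B` is a morphism of Hopf algebras. -/
theorem HopfAlgebra.eq_of_surjective {A B : Type*} [Ring A] [Ring B] (hA : HopfAlgebra k A)
    (h h' : HopfAlgebra k B) (he : h.toAlgebra = h'.toAlgebra) (f : A → B)
    (hf : Function.Surjective f) (H : IsHopfHom k hA h f) (H' : IsHopfHom k hA h' f) : h = h' := by
  -- Both structures are split into their fields, so that once the data agree, substitution leaves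
  -- only proofs to compare.
  obtain @⟨@⟨@⟨alg, @⟨⟨Δ, ε⟩, h1, h2, h3⟩, h4, h5, h6, h7⟩, S⟩, h8, h9⟩ := h
  obtain @⟨@⟨@⟨alg', @⟨⟨Δ', ε'⟩, h1', h2', h3'⟩, h4', h5', h6', h7'⟩, S'⟩, h8', h9'⟩ := h'
  obtain rfl : alg = alg' := he
  obtain ⟨φ, hφ⟩ := H
  obtain ⟨φ', hφ'⟩ := H'
  let p : A →ₗ[k] B := φ.toCoalgHom.toLinearMap
  let p' : A →ₗ[k] B := φ'.toCoalgHom.toLinearMap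
  have hpp : p = p' := LinearMap.ext fun x => (hφ x).trans (hφ' x).symm
  have hε : ε = ε' := by
    ext b
    obtain ⟨a, rfl⟩ := hf b
    have e1 : ε (p a) = counit (R := k) a := LinearMap.congr_fun φ.counit_comp a
    have e2 : ε' (p' a) = counit (R := k) a := LinearMap.congr_fun φ'.counit_comp a
    have e3 : p a = f a := hφ a
    rw [← hpp] at e2
    rw [← e3, e1, e2]
  have hΔ : Δ = Δ' := by
    ext b
    obtain ⟨a, rfl⟩ := hf b
    have e1 : TensorProduct.map p p (comul (R := k) a) = Δ (p a) :=
      LinearMap.congr_fun φ.map_comp_comul a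
    have e2 : TensorProduct.map p' p' (comul (R := k) a) = Δ' (p' a) :=
      LinearMap.congr_fun φ'.map_comp_comul a
    have e3 : p a = f a := hφ a
    rw [← hpp] at e2
    rw [← e3, ← e1, e2]
  subst hε hΔ
  have hS : S = S' := by
    let _ : Coalgebra k B := @Coalgebra.mk k B _ _ _ ⟨Δ, ε⟩ h1 h2 h3
    -- An antipode is the convolution inverse of the identity: `S` serves as left inverse, `S'` as
    -- right inverse, hence they coincide.
    have e1 : toConv S * toConv (LinearMap.id : B →ₗ[k] B) = 1 := by
      ext1
      exact h8
    have e2 : toConv (LinearMap.id : B →ₗ[k] B) * toConv S' = 1 := by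
      ext1
      exact h9'
    exact congrArg WithConv.ofConv (left_inv_eq_right_inv e1 e2)
  subst hS
  rfl

theorem RingAb.existsUnique_hopfAlgebra {R : Type v} [Ring R] [hR : HopfAlgebra k R] :
    ∃! h : HopfAlgebra k (RingAb R),
      h.toAlgebra = RingAb.algebra k R ∧ IsHopfHom k hR h (RingAb.proj R) := by
  refine ⟨inferInstanceAs (HopfAlgebra k (R ⧸ (commutatorIdeal R).asIdeal)),
    ⟨rfl, Bialgebra.Quotient.mkBialgHom (R := k) (commutatorIdeal R).asIdeal, fun _ => rfl⟩,
    fun h' hh' => ?_⟩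
  exact HopfAlgebra.eq_of_surjective hR _ _ hh'.1 _ (RingAb.proj_surjective R) hh'.2
    ⟨Bialgebra.Quotient.mkBialgHom (R := k) (commutatorIdeal R).asIdeal, fun _ => rfl⟩

theorem isCocomm_of_surjective {A B : Type*} [Ring A] [Bialgebra k A] [Ring B] [Bialgebra k B]
    [IsCocomm k A] (π : A →ₐc[k] B) (hπ : Function.Surjective π) : IsCocomm k B where
  comm_comp_comul := by
    ext b
    obtain ⟨a, rfl⟩ := hπ b
    have h : comul (R := k) (π a) = TensorProduct.map (π : A →ₗ[k] B) (π : A →ₗ[k] B) (comul a) :=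
      (CoalgHomClass.map_comp_comul_apply π a).symm
    rw [LinearMap.comp_apply, h, LinearEquiv.coe_coe, ← TensorProduct.map_comm, comm_comul]

namespace FiniteDual

/-- Swapping the factors of `Δ(f)` replaces `f(xy)` by `f(yx)`, and elements of the tensor square
are determined by such values. -/
theorem isCocomm_of_mul_comm {S : Type v} [Ring S] [Bialgebra k S]
    (h : ∀ a b : S, a * b = b * a) : IsCocomm k (FiniteDual k S) where
  comm_comp_comul := by
    ext f
    refine tensor_ext fun x y => ?_
    rw [LinearMap.comp_apply, LinearEquiv.coe_coe, TensorProduct.formMul_comm, formMul_comul,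
      formMul_comul, h]

variable {R S : Type v} [Ring R] [Ring S]

theorem map_injective [Bialgebra k R] [Bialgebra k S] (π : R →ₐc[k] S)
    (hπ : Function.Surjective π) : Function.Injective (map π) := by
  intro f g h
  ext y
  obtain ⟨x, rfl⟩ := hπ y
  rw [← map_apply, ← map_apply, h]

/-- An element of `R°` vanishing on the kernel of a surjective morphism `R → S` comes from `S°`. -/
theorem exists_map_eq [Bialgebra k R] [Bialgebra k S] (π : R →ₐc[k] S)
    (hπ : Function.Surjective π) (f : FiniteDual k R) (hf : ∀ x, π x = 0 → f x = 0) :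
    ∃ g, map π g = f := by
  obtain ⟨I, hI, hfin, hIf⟩ := f.2
  let p : R →ₗ[k] S := (π : R →ₗ[k] S)
  -- A linear section suffices: `f` is constant on the fibres of `π`, so `f ∘ s` is the descended
  -- form whatever section is chosen.
  obtain ⟨s, hs⟩ := p.exists_rightInverse_of_surjective (LinearMap.range_eq_top.mpr hπ)
  have hsp : ∀ x, f (s (π x)) = f x := fun x => by
    rw [← sub_eq_zero, ← map_sub]
    refine hf _ ?_
    rw [map_sub, sub_eq_zero]
    exact LinearMap.congr_fun hs (π x)
  -- As `π` is onto, the image of `I` is exactly the set `π(I)`; it is two-sided, and `S/J` is a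
  -- quotient of `R/I`.
  let J : Ideal S := Ideal.map (π : R →+* S) I
  have hJ : ∀ {y}, y ∈ J ↔ ∃ x ∈ I, π x = y := Ideal.mem_map_iff_of_surjective _ hπ
  refine ⟨mk (f.toLin ∘ₗ s) ⟨J, ⟨fun {a} b ha => ?_⟩, ?_, fun y hy => ?_⟩, ext fun x => hsp x⟩
  · obtain ⟨x, hx, rfl⟩ := hJ.mp ha
    obtain ⟨z, rfl⟩ := hπ b
    exact hJ.mpr ⟨x * z, I.mul_mem_right z hx, map_mul π x z⟩
  · refine Module.Finite.of_surjective ((I.restrictScalars k).mapQ (J.restrictScalars k) p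
      fun x hx => hJ.mpr ⟨x, hx, rfl⟩) ?_
    rintro ⟨y⟩
    obtain ⟨x, rfl⟩ := hπ y
    exact ⟨Submodule.Quotient.mk x, rfl⟩
  · obtain ⟨x, hx, rfl⟩ := hJ.mp hy
    exact (hsp x).trans (hIf x hx)

/-- The values of `φ c` on products are governed by the comultiplication of `C`. Properties of `C`
thereby become vanishing statements for forms on `R`. -/
theorem formMul_comul_apply [Bialgebra k R] {C : Type*} [Ring C] [Bialgebra k C]
    (φ : C →ₐc[k] FiniteDual k R) (c : C) (x y : R) :
    formMul (ev x ∘ₗ (φ : C →ₗ[k] FiniteDual k R)) (ev y ∘ₗ (φ : C →ₗ[k] FiniteDual k R))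
      (comul c) = φ c (x * y) := by
  rw [← formMul_map, ← formMul_comul]
  exact congrArg _ (CoalgHomClass.map_comp_comul_apply φ c)

/-- A morphism from a cocommutative bialgebra to `R°` takes values in the forms vanishing on the
commutator ideal. -/
theorem apply_eq_zero_of_mem_commutatorIdeal [Bialgebra k R] {C : Type*} [Ring C]
    [Bialgebra k C] [IsCocomm k C] (φ : C →ₐc[k] FiniteDual k R) {x : R}
    (hx : x ∈ commutatorIdeal R) (c : C) : φ c x = 0 := by
  -- The statement must be carried for all `c` at once: in the absorption cases the value at a
  -- product involves the tensor factors of `Δ(c)`, not `c` itself.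
  induction hx using TwoSidedIdeal.span_induction generalizing c with
  | mem x h =>
    obtain ⟨x, y, rfl⟩ := h
    rw [map_sub, ← formMul_comul_apply, ← formMul_comul_apply, ← TensorProduct.formMul_comm,
      comm_comul, sub_self]
  | zero => rw [map_zero]
  | add x y _ _ hx hy => rw [map_add, hx, hy, add_zero]
  | neg x _ hx => rw [map_neg, hx, neg_zero]
  | left_absorb a x _ hx =>
    have h0 : ev x ∘ₗ (φ : C →ₗ[k] FiniteDual k R) = 0 := LinearMap.ext hx
    rw [← formMul_comul_apply, h0, TensorProduct.formMul_zero_right]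
  | right_absorb a x _ hx =>
    have h0 : ev x ∘ₗ (φ : C →ₗ[k] FiniteDual k R) = 0 := LinearMap.ext hx
    rw [← formMul_comul_apply, h0, TensorProduct.formMul_zero_left]

end FiniteDual

/-- The kernel of `π` is the commutator ideal, so a form in `R°` comes from `(R^ab)°` as soon as it
vanishes on that ideal; forms in the image of a cocommutative Hopf algebra do. -/
theorem isLargestQuotient_ringAb {R : Type u} [Ring R] [HopfAlgebra k R] [IsCocomm k R]
    [HopfAlgebra k (RingAb R)] [IsCocomm k (RingAb R)] (π : R →ₐc[k] RingAb R)
    (hπ : ∀ x, π x = RingAb.proj R x) :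
    IsLargestQuotient IsAbelianGrpSch (specGrpMap (FiniteDual.map π)) := by
  have hs : Function.Surjective π := fun y =>
    (RingAb.proj_surjective R y).imp fun x hx => (hπ x).trans hx
  refine isLargestQuotient_specGrpMap _ _ (FiniteDual.map_injective π hs)
    ((isAbelianGrpSch_specGrp_iff _).mpr (FiniteDual.isCocomm_of_mul_comm RingAb.mul_comm))
    fun H hH hab => ?_
  obtain ⟨C, _, _, ⟨e⟩⟩ := exists_iso_specGrp H hH
  refine ⟨C, _, _, ⟨e⟩, fun φ c => FiniteDual.exists_map_eq π hs _ fun x hx => ?_⟩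
  have : IsCocomm k C := (isAbelianGrpSch_specGrp_iff C).mp (hab.of_iso e)
  rw [hπ, RingAb.proj_eq_zero_iff] at hx
  exact FiniteDual.apply_eq_zero_of_mem_commutatorIdeal φ hx c

end CommutatorQuotient

/-! ### `R†` is a Hopf subalgebra -/

section UnipotentDual

variable {k : Type u} [Field k]

theorem Ideal.linearMap_eq_zero_of_mem_mul {R M : Type*} [Ring R] [Algebra k R] [AddCommGroup M]
    [Module k M] {I J : Ideal R} (f : R →ₗ[k] M) (h : ∀ x ∈ I, ∀ y ∈ J, f (x * y) = 0) {z : R}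
    (hz : z ∈ I * J) : f z = 0 := by
  refine Submodule.mul_induction_on hz h fun x y hx hy => ?_
  rw [map_add, hx, hy, add_zero]

theorem Ideal.isTwoSided_sup {R : Type*} [Ring R] (I J : Ideal R) [I.IsTwoSided] [J.IsTwoSided] :
    (I ⊔ J).IsTwoSided where
  mul_mem_of_left b h := by
    obtain ⟨x, hx, y, hy, rfl⟩ := Submodule.mem_sup.mp h
    rw [add_mul]
    exact add_mem (Ideal.mem_sup_left (I.mul_mem_right b hx))
      (Ideal.mem_sup_right (J.mul_mem_right b hy))

section AugmentationIdeal

variable (k) (R : Type v) [Ring R]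

instance augmentationIdeal_isTwoSided [Bialgebra k R] : (augmentationIdeal k R).IsTwoSided :=
  inferInstanceAs (RingHom.ker (Bialgebra.counitAlgHom k R)).IsTwoSided

variable {k R}

theorem mem_augmentationIdeal_iff [Bialgebra k R] {x : R} :
    x ∈ augmentationIdeal k R ↔ counit (R := k) x = 0 := Iff.rfl

theorem sub_algebraMap_counit_mem_augmentationIdeal [Bialgebra k R] (x : R) :
    x - algebraMap k R (counit x) ∈ augmentationIdeal k R := by
  rw [mem_augmentationIdeal_iff, map_sub, Bialgebra.counit_algebraMap, sub_self]

/-- The antipode preserves `𝔞` and reverses products, so it carries `𝔞 · 𝔞^n` into `𝔞^n · 𝔞`, which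
is the same power. -/
theorem antipode_mem_augmentationIdeal_pow [HopfAlgebra k R] (n : ℕ) :
    ∀ x ∈ augmentationIdeal k R ^ n, HopfAlgebra.antipode k x ∈ augmentationIdeal k R ^ n := by
  induction n with
  | zero => intro x _; rw [Submodule.pow_zero, Ideal.one_eq_top]; trivial
  | succ n ih =>
    intro x hx
    rw [Ideal.IsTwoSided.pow_succ] at hx
    -- Membership is recast as the vanishing of a linear map to the quotient, so that it need only
    -- be checked on products.
    have h := Ideal.linearMap_eq_zero_of_mem_mul (k := k)
      (((augmentationIdeal k R ^ (n + 1)).restrictScalars k).mkQ ∘ₗ HopfAlgebra.antipode k)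
      (fun y hy z hz => by
        rw [LinearMap.comp_apply, HopfAlgebra.antipode_mul_antidistrib, Submodule.mkQ_apply,
          Submodule.Quotient.mk_eq_zero, Submodule.restrictScalars_mem, Submodule.pow_succ]
        refine Ideal.mul_mem_mul (ih z hz) ?_
        rw [mem_augmentationIdeal_iff, HopfAlgebra.counit_antipode]
        exact hy) hx
    rwa [LinearMap.comp_apply, Submodule.mkQ_apply, Submodule.Quotient.mk_eq_zero] at h

/-- Expanding only `Δ(x)` in `Δ(x)Δ(y)` moves `x` into the forms as left multiplications. This is
what permits peeling one factor of `𝔞` off a power at a time. -/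
theorem formMul_comul_mul [Bialgebra k R] (f g : R →ₗ[k] k) (x y : R) {ι : Type*}
    (r : Coalgebra.Repr k x ι) :
    formMul f g (comul (x * y)) = ∑ i ∈ r.index,
      formMul (f ∘ₗ LinearMap.mulLeft k (r.left i)) (g ∘ₗ LinearMap.mulLeft k (r.right i))
        (comul y) := by
  rw [Bialgebra.comul_mul, ← r.eq, Finset.sum_mul, map_sum]
  refine Finset.sum_congr rfl fun i _ => ?_
  rw [← formMul_map]
  congr 1
  generalize comul (R := k) y = t
  induction t using TensorProduct.induction_on with
  | zero => rw [mul_zero, map_zero]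
  | add a b ha hb => rw [mul_add, map_add, ha, hb]
  | tmul a b => rw [Algebra.TensorProduct.tmul_mul_tmul]; rfl

/-- The convolution product of forms vanishing on the `n`-th and on the `m`-th power of the
augmentation ideal vanishes on its `n + m`-th power. -/
theorem formMul_comul_eq_zero_of_mem_pow [Bialgebra k R] (N : ℕ) : ∀ (n m : ℕ) (f g : R →ₗ[k] k),
    n + m = N → (∀ x ∈ augmentationIdeal k R ^ n, f x = 0) →
    (∀ x ∈ augmentationIdeal k R ^ m, g x = 0) →
    ∀ x ∈ augmentationIdeal k R ^ N, formMul f g (comul x) = 0 := by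
  have htop : ∀ f : R →ₗ[k] k, (∀ x ∈ augmentationIdeal k R ^ 0, f x = 0) → f = 0 := fun f hf =>
    LinearMap.ext fun x => hf x (by rw [Submodule.pow_zero, Ideal.one_eq_top]; trivial)
  induction N with
  | zero =>
    intro n m f g h hf hg x _
    obtain rfl : n = 0 := by omega
    rw [htop f hf, TensorProduct.formMul_zero_left]
  | succ N ih =>
    intro n m f g h hf hg x hx
    rcases n with _ | n
    · rw [htop f hf, TensorProduct.formMul_zero_left]
    rcases m with _ | m
    · rw [htop g hg, TensorProduct.formMul_zero_right]
    have hmul : ∀ (l : R →ₗ[k] k) (j : ℕ) (z : R), (∀ x ∈ augmentationIdeal k R ^ j, l x = 0) →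
        ∀ x ∈ augmentationIdeal k R ^ j, (l ∘ₗ LinearMap.mulLeft k z) x = 0 :=
      fun l j z hl x hx => hl _ (Ideal.mul_mem_left _ z hx)
    have hmul' : ∀ (l : R →ₗ[k] k) (j : ℕ), ∀ z ∈ augmentationIdeal k R,
        (∀ x ∈ augmentationIdeal k R ^ (j + 1), l x = 0) →
        ∀ x ∈ augmentationIdeal k R ^ j, (l ∘ₗ LinearMap.mulLeft k z) x = 0 :=
      fun l j z hz hl x hx => hl _ (by rw [Ideal.IsTwoSided.pow_succ]; exact Ideal.mul_mem_mul hz hx)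
    rw [Ideal.IsTwoSided.pow_succ] at hx
    refine Ideal.linearMap_eq_zero_of_mem_mul (formMul f g ∘ₗ comul) (fun z hz y hy => ?_) hx
    rw [LinearMap.comp_apply, formMul_comul_mul f g z y (ℛ k z)]
    -- For `z ∈ 𝔞` with `Δ(z) = ∑ a ⊗ b`, write `a = (a - ε(a)) + ε(a)`. Then `Δ(z) = ∑ (a - ε(a)) ⊗
    -- b + 1 ⊗ z`, and each term has a factor in `𝔞`.
    have hsplit : ∀ i, formMul (f ∘ₗ LinearMap.mulLeft k ((ℛ k z).left i))
        (g ∘ₗ LinearMap.mulLeft k ((ℛ k z).right i)) (comul y) =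
        formMul f (g ∘ₗ LinearMap.mulLeft k
          (counit (R := k) ((ℛ k z).left i) • (ℛ k z).right i)) (comul y) := by
      intro i
      set a := (ℛ k z).left i
      set b := (ℛ k z).right i
      -- The factor `a - ε(a) ∈ 𝔞` lowers the exponent for `f` from `n + 1` to `n`; the exponent for
      -- `g` stays `m + 1`.
      have h0 := ih n (m + 1) (f ∘ₗ LinearMap.mulLeft k (a - algebraMap k R (counit a)))
        (g ∘ₗ LinearMap.mulLeft k b) (by omega)
        (hmul' f n _ (sub_algebraMap_counit_mem_augmentationIdeal a) hf) (hmul g _ b hg) y hy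
      have e1 : f ∘ₗ LinearMap.mulLeft k a =
          f ∘ₗ LinearMap.mulLeft k (a - algebraMap k R (counit a)) + counit (R := k) a • f := by
        ext w
        simp [sub_mul, Algebra.algebraMap_eq_smul_one]
      have e2 : g ∘ₗ LinearMap.mulLeft k (counit (R := k) a • b) =
          counit (R := k) a • (g ∘ₗ LinearMap.mulLeft k b) := by
        ext w
        simp
      rw [formMul] at h0 ⊢
      rw [e1, TensorProduct.map_add_left, LinearMap.comp_add, LinearMap.add_apply, h0, zero_add, e2,
        TensorProduct.map_smul_left, formMul, TensorProduct.map_smul_right]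
    rw [Finset.sum_congr rfl fun i _ => hsplit i]
    have hsum : ∑ i ∈ (ℛ k z).index, formMul f (g ∘ₗ LinearMap.mulLeft k
        (counit (R := k) ((ℛ k z).left i) • (ℛ k z).right i)) (comul y) =
        formMul f (g ∘ₗ LinearMap.mulLeft k z) (comul y) := by
      have hz' := Coalgebra.sum_counit_smul (ℛ k z)
      let Φ : R →ₗ[k] k :=
        { toFun w := formMul f (g ∘ₗ LinearMap.mulLeft k w) (comul y)
          map_add' a b := by
            have : g ∘ₗ LinearMap.mulLeft k (a + b) =
                g ∘ₗ LinearMap.mulLeft k a + g ∘ₗ LinearMap.mulLeft k b := by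
              ext w
              simp [add_mul]
            rw [this, formMul, TensorProduct.map_add_right, LinearMap.comp_add,
              LinearMap.add_apply]
            rfl
          map_smul' c a := by
            have : g ∘ₗ LinearMap.mulLeft k (c • a) = c • (g ∘ₗ LinearMap.mulLeft k a) := by
              ext w
              simp
            rw [this, formMul, TensorProduct.map_smul_right, LinearMap.comp_smul,
              LinearMap.smul_apply]
            rfl }
      change ∑ i ∈ (ℛ k z).index, Φ _ = Φ z
      rw [← map_sum, hz']
    rw [hsum]
    -- In the remaining term `1 ⊗ z` it is `g` whose exponent drops.
    exact ih (n + 1) m _ _ (by omega) hf (hmul' g m z hz hg) y hy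

end AugmentationIdeal

/-- Since `R/I` is finite dimensional, `(x, y) ↦ f(xy)` on it is a finite sum of products of forms
on `R/I`. Pulled back to `R`, these vanish on `I` and hence lie in `W`. -/
theorem FiniteDual.comul_mem_range_of_vanishing {R : Type v} [Ring R] [Bialgebra k R]
    (W : Submodule k (FiniteDual k R)) (f : FiniteDual k R) (I : Ideal R) [I.IsTwoSided]
    [FiniteDimensional k (R ⧸ I.restrictScalars k)] (hf : ∀ x ∈ I, f x = 0)
    (hW : ∀ g : FiniteDual k R, (∀ x ∈ I, g x = 0) → g ∈ W) :
    comul (R := k) f ∈ LinearMap.range (TensorProduct.map W.subtype W.subtype) := by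
  have : FiniteDimensional k (R ⧸ I) :=
    inferInstanceAs (FiniteDimensional k (R ⧸ I.restrictScalars k))
  let φ : R →ₐ[k] R ⧸ I := Ideal.Quotient.mkₐ k I
  let g : R ⧸ I →ₗ[k] k := (I.restrictScalars k).liftQ f.toLin hf
  have hφ : ∀ x ∈ I, φ x = 0 := fun x hx => Ideal.Quotient.eq_zero_iff_mem.mpr hx
  let ρ : Module.Dual k (R ⧸ I) →ₗ[k] W :=
    { toFun l := ⟨mk (l ∘ₗ φ.toLinearMap) (.of_algHom φ _ fun x hx => by simp [hx]),
        hW _ fun x hx => by simp [hφ x hx]⟩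
      map_add' _ _ := rfl
      map_smul' _ _ := rfl }
  let T := (TensorProduct.dualDistribEquiv k (R ⧸ I) (R ⧸ I)).symm (g ∘ₗ LinearMap.mul' k (R ⧸ I))
  refine ⟨TensorProduct.map ρ ρ T, tensor_ext fun x y => ?_⟩
  have key : ∀ t : Module.Dual k (R ⧸ I) ⊗[k] Module.Dual k (R ⧸ I),
      formMul (ev x) (ev y) (TensorProduct.map W.subtype W.subtype (TensorProduct.map ρ ρ t)) =
        TensorProduct.dualDistribEquiv k (R ⧸ I) (R ⧸ I) t (φ x ⊗ₜ φ y) := by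
    intro t
    induction t using TensorProduct.induction_on with
    | zero => simp
    | tmul a b =>
      rw [TensorProduct.map_tmul, TensorProduct.map_tmul, formMul_tmul]
      exact (TensorProduct.dualDistrib_apply a b (φ x) (φ y)).symm
    | add a b ha hb => simp only [map_add, ha, hb, LinearMap.add_apply]
  rw [key, LinearEquiv.apply_symm_apply, LinearMap.comp_apply, LinearMap.mul'_apply, ← map_mul,
    formMul_comul]
  rfl

theorem isHopfSubalgebra_unipotentDual {R : Type v} [Ring R] [HopfAlgebra k R] [IsCocomm k R] :
    (unipotentDual k R).IsHopfSubalgebra where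
  one_mem := ⟨1, le_rfl, fun x hx => by
    rw [Submodule.pow_one, mem_augmentationIdeal_iff] at hx
    rw [FiniteDual.one_apply, hx]⟩
  mul_mem := by
    rintro f g ⟨n, hn, hf⟩ ⟨m, -, hg⟩
    exact ⟨n + m, by omega,
      formMul_comul_eq_zero_of_mem_pow (n + m) n m f.toLin g.toLin rfl hf hg⟩
  comul_mem := by
    rintro f ⟨n, hn, hf⟩
    obtain ⟨I, hI, hfin, hIf⟩ := f.2
    -- The power `𝔞^n` alone may have infinite codimension. Adding `I` makes the codimension finite,
    -- `f` still vanishes on the sum, and every form vanishing on the sum lies in `R†`.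
    have := Ideal.isTwoSided_sup I (augmentationIdeal k R ^ n)
    have : FiniteDimensional k (R ⧸ (I ⊔ augmentationIdeal k R ^ n).restrictScalars k) := by
      refine Module.Finite.of_surjective ((I.restrictScalars k).mapQ
        ((I ⊔ augmentationIdeal k R ^ n).restrictScalars k) LinearMap.id
        fun x hx => Ideal.mem_sup_left hx) ?_
      rintro ⟨y⟩
      exact ⟨Submodule.Quotient.mk y, rfl⟩
    refine FiniteDual.comul_mem_range_of_vanishing _ f (I ⊔ augmentationIdeal k R ^ n)
      (fun x hx => ?_) fun g hg => ⟨n, hn, fun x hx => hg x (Ideal.mem_sup_right hx)⟩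
    obtain ⟨a, ha, b, hb, rfl⟩ := Submodule.mem_sup.mp hx
    rw [map_add, hf b hb, add_zero]
    exact hIf a ha
  antipode_mem := by
    rintro f ⟨n, hn, hf⟩
    exact ⟨n, hn, fun x hx => hf _ (antipode_mem_augmentationIdeal_pow n x hx)⟩

end UnipotentDual

/-! ### Comodules and the largest unipotent quotient -/

section Unipotent

variable {k : Type u} [Field k]

/-- The endomorphism of a comodule defined by a linear form `e` on the coalgebra. -/
noncomputable def comoduleAct {A V : Type*} [AddCommGroup A] [Module k A] [AddCommGroup V]
    [Module k V] (ρ : V →ₗ[k] V ⊗[k] A) (e : A →ₗ[k] k) : V →ₗ[k] V :=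
  (TensorProduct.rid k V).toLinearMap ∘ₗ e.lTensor V ∘ₗ ρ

section Comodule

variable {A V : Type*} [AddCommGroup A] [Module k A] [AddCommGroup V] [Module k V]
  {ρ : V →ₗ[k] V ⊗[k] A}

theorem comoduleAct_apply (e : A →ₗ[k] k) (v : V) :
    comoduleAct ρ e v = TensorProduct.rid k V (e.lTensor V (ρ v)) := rfl

theorem apply_comoduleAct (l : V →ₗ[k] k) (e : A →ₗ[k] k) (v : V) :
    l (comoduleAct ρ e v) = formMul l e (ρ v) := by
  rw [comoduleAct_apply]
  induction ρ v using TensorProduct.induction_on with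
  | zero => simp only [map_zero]
  | add a b ha hb => simp only [map_add, ha, hb]
  | tmul a b => simp [mul_comm]

variable [Coalgebra k A]

theorem IsCoaction.act_counit (h : IsCoaction ρ) (v : V) : comoduleAct ρ Coalgebra.counit v = v :=
  LinearMap.congr_fun h.counit v

/-- Coassociativity turns a comodule into a left module over the convolution algebra of linear
forms. For evaluations at points of `R`, convolution is multiplication in `R`, so `R` acts. -/
theorem IsCoaction.act_comp_act (h : IsCoaction ρ) (e e' : A →ₗ[k] k) (v : V) :
    comoduleAct ρ e (comoduleAct ρ e' v) = comoduleAct ρ (formMul e e' ∘ₗ comul) v := by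
  have key : ∀ t : V ⊗[k] A, comoduleAct ρ e (TensorProduct.rid k V (e'.lTensor V t)) =
      TensorProduct.rid k V ((formMul e e').lTensor V
        (TensorProduct.assoc k V A A (ρ.rTensor A t))) := by
    intro t
    induction t using TensorProduct.induction_on with
    | zero => simp only [map_zero]
    | add a b ha hb => simp only [map_add, ha, hb]
    | tmul w a =>
      rw [LinearMap.lTensor_tmul, TensorProduct.rid_tmul, map_smul, LinearMap.rTensor_tmul,
        comoduleAct_apply]
      induction ρ w using TensorProduct.induction_on with
      | zero => simp only [map_zero, smul_zero, TensorProduct.zero_tmul]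
      | add a b ha hb => simp only [map_add, smul_add, TensorProduct.add_tmul, ha, hb]
      | tmul u b => simp [smul_smul, mul_comm]
  rw [comoduleAct_apply e' v, key, comoduleAct_apply, LinearMap.lTensor_comp,
    LinearMap.comp_apply]
  exact congrArg (fun z => TensorProduct.rid k V ((formMul e e').lTensor V z))
    (LinearMap.congr_fun h.coassoc v)

end Comodule

/-- If each nonzero comodule of `B` has a nonzero fixed vector, then a subspace `N` of `B` is the
whole of `B` as soon as it contains each `b` that is fixed modulo a subspace of `N`. -/
theorem eq_top_of_forall_exists_fixed {B : Type u} [CommRing B] [HopfAlgebra k B]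
    (hB : ∀ (V : Type u) [AddCommGroup V] [Module k V] [Nontrivial V] (ρ : V →ₗ[k] V ⊗[k] B),
      IsCoaction ρ → ∃ v : V, v ≠ 0 ∧ ρ v = v ⊗ₜ 1)
    (N : Submodule k B)
    (hN : ∀ (U : Submodule k B) (b : B), U ≤ N →
      comul b - b ⊗ₜ[k] 1 ∈ LinearMap.range (U.subtype.rTensor B) → b ∈ N) : N = ⊤ := by
  -- The second condition says `Δ(U) ⊆ U ⊗ B`. So `S` consists of the subcomodules of `B` inside
  -- `N`, and their sum `W` is the largest one.
  let S : Set (Submodule k B) := {U | U ≤ N ∧ ∀ u ∈ U, U.mkQ.rTensor B (comul u) = 0}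
  let W : Submodule k B := sSup S
  have hmono : ∀ {U U' : Submodule k B} (t : B ⊗[k] B), U ≤ U' → U.mkQ.rTensor B t = 0 →
      U'.mkQ.rTensor B t = 0 := by
    intro U U' t hU ht
    have hc : U'.mkQ = Submodule.factor hU ∘ₗ U.mkQ := rfl
    rw [hc, LinearMap.rTensor_comp, LinearMap.comp_apply, ht, map_zero]
  have hWN : W ≤ N := sSup_le fun U hU => hU.1
  have hW : ∀ u ∈ W, W.mkQ.rTensor B (comul u) = 0 := by
    have : W ≤ LinearMap.ker (W.mkQ.rTensor B ∘ₗ (comul : B →ₗ[k] B ⊗[k] B)) :=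
      sSup_le fun U hU u hu => hmono _ (le_sSup hU) (hU.2 u hu)
    exact this
  by_contra hNtop
  have hWtop : W ≠ ⊤ := fun h => hNtop (top_le_iff.mp (h ▸ hWN))
  have : Nontrivial (B ⧸ W) := Submodule.Quotient.nontrivial_iff.mpr hWtop
  -- The quotient comodule; a fixed vector in it yields an element by which `W` can be enlarged.
  let ρ : B ⧸ W →ₗ[k] (B ⧸ W) ⊗[k] B := W.liftQ (W.mkQ.rTensor B ∘ₗ comul) hW
  have hρ : ρ ∘ₗ W.mkQ = W.mkQ.rTensor B ∘ₗ comul := W.liftQ_mkQ _ _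
  have hco : IsCoaction ρ := by
    constructor
    · refine Submodule.linearMap_qext _ (LinearMap.ext fun b => ?_)
      have h1 : ∀ t : B ⊗[k] B, ρ.rTensor B (W.mkQ.rTensor B t) =
          (W.mkQ.rTensor B).rTensor B (comul.rTensor B t) := fun t => by
        rw [← LinearMap.comp_apply, ← LinearMap.rTensor_comp, hρ, LinearMap.rTensor_comp,
          LinearMap.comp_apply]
      have h2 : ∀ t : (B ⊗[k] B) ⊗[k] B, TensorProduct.assoc k (B ⧸ W) B B
          ((W.mkQ.rTensor B).rTensor B t) =
          W.mkQ.rTensor (B ⊗[k] B) (TensorProduct.assoc k B B B t) := fun t => by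
        have : (TensorProduct.assoc k (B ⧸ W) B B).toLinearMap ∘ₗ (W.mkQ.rTensor B).rTensor B =
            W.mkQ.rTensor (B ⊗[k] B) ∘ₗ (TensorProduct.assoc k B B B).toLinearMap := by
          ext a b c
          rfl
        exact LinearMap.congr_fun this t
      have h3 : ∀ t : B ⊗[k] B, (comul : B →ₗ[k] B ⊗[k] B).lTensor (B ⧸ W) (W.mkQ.rTensor B t) =
          W.mkQ.rTensor (B ⊗[k] B) (comul.lTensor B t) := fun t => by
        rw [← LinearMap.comp_apply, ← LinearMap.comp_apply, LinearMap.lTensor_comp_rTensor,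
          LinearMap.rTensor_comp_lTensor]
      change TensorProduct.assoc k (B ⧸ W) B B (ρ.rTensor B (W.mkQ.rTensor B (comul b))) =
        comul.lTensor (B ⧸ W) (W.mkQ.rTensor B (comul b))
      rw [h1, h2, h3, Coalgebra.coassoc_apply]
    · refine Submodule.linearMap_qext _ (LinearMap.ext fun b => ?_)
      change TensorProduct.rid k (B ⧸ W) (counit.lTensor (B ⧸ W) (W.mkQ.rTensor B (comul b))) =
        W.mkQ b
      rw [← LinearMap.comp_apply (counit.lTensor (B ⧸ W)), LinearMap.lTensor_comp_rTensor,
        ← LinearMap.rTensor_comp_lTensor, LinearMap.comp_apply, Coalgebra.lTensor_counit_comul,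
        LinearMap.rTensor_tmul, TensorProduct.rid_tmul, one_smul]
  obtain ⟨v, hv, hfix⟩ := hB _ ρ hco
  obtain ⟨b, rfl⟩ := W.mkQ_surjective v
  have hb : W.mkQ.rTensor B (comul b - b ⊗ₜ[k] 1) = 0 := by
    rw [map_sub, sub_eq_zero]
    exact hfix
  -- Right exactness of the tensor product gives `Δ(b) - b ⊗ 1 ∈ W ⊗ B`, which is the hypothesis of
  -- `hN`.
  have hbN : b ∈ N := hN W b hWN
    ((rTensor_exact B (LinearMap.exact_subtype_mkQ W) W.mkQ_surjective _).mp hb)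
  -- `W + kb` is again a subcomodule inside `N`, so maximality puts `b` in `W`, against `v ≠ 0`.
  have hbW : W ⊔ Submodule.span k {b} ≤ W := by
    refine le_sSup ⟨sup_le hWN ((Submodule.span_singleton_le_iff_mem b N).mpr hbN), ?_⟩
    have hle : W ⊔ Submodule.span k {b} ≤
        LinearMap.ker ((W ⊔ Submodule.span k {b}).mkQ.rTensor B ∘ₗ
          (comul : B →ₗ[k] B ⊗[k] B)) := by
      refine sup_le (fun u hu => hmono _ le_sup_left (hW u hu)) ?_
      rw [Submodule.span_singleton_le_iff_mem, LinearMap.mem_ker, LinearMap.comp_apply,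
        ← sub_add_cancel (comul b) (b ⊗ₜ[k] (1 : B)), map_add, hmono _ le_sup_left hb,
        LinearMap.rTensor_tmul, zero_add, Submodule.mkQ_apply,
        (Submodule.Quotient.mk_eq_zero _).mpr (Submodule.mem_sup_right
          (Submodule.mem_span_singleton_self b)), TensorProduct.zero_tmul]
    exact hle
  exact hv ((Submodule.Quotient.mk_eq_zero W).mpr
    (hbW (Submodule.mem_sup_right (Submodule.mem_span_singleton_self b))))

variable {R : Type u} [Ring R] [HopfAlgebra k R] [IsCocomm k R]

/-- A morphism from the ring of functions of a unipotent group scheme to `R°` takes values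
in `R†`. -/
theorem mem_unipotentDual_of_forall_exists_fixed {B : Type u} [CommRing B] [HopfAlgebra k B]
    (hB : ∀ (V : Type u) [AddCommGroup V] [Module k V] [Nontrivial V] (ρ : V →ₗ[k] V ⊗[k] B),
      IsCoaction ρ → ∃ v : V, v ≠ 0 ∧ ρ v = v ⊗ₜ 1)
    (φ : B →ₐc[k] FiniteDual k R) (b : B) : φ b ∈ unipotentDual k R := by
  let p : B →ₗ[k] FiniteDual k R := (φ : B →ₗ[k] FiniteDual k R)
  have htop := eq_top_of_forall_exists_fixed hB ((unipotentDual k R).comap p) ?_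
  · exact Submodule.mem_comap.mp (htop.symm ▸ Submodule.mem_top (x := b))
  rintro U b hU ⟨t, ht⟩
  -- A tensor is a finite sum whose left factors map into `R†`, so one power of `𝔞` works for all of
  -- them.
  have hfin : ∀ t : U ⊗[k] B, ∃ n : ℕ, ∀ y ∈ augmentationIdeal k R ^ n, ∀ z,
      formMul (FiniteDual.ev y ∘ₗ p) (FiniteDual.ev z ∘ₗ p) (U.subtype.rTensor B t) = 0 := by
    intro t
    induction t using TensorProduct.induction_on with
    | zero => exact ⟨0, fun _ _ _ => by simp only [map_zero]⟩
    | add s t hs ht =>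
      obtain ⟨n, hn⟩ := hs
      obtain ⟨m, hm⟩ := ht
      refine ⟨n + m, fun y hy z => ?_⟩
      rw [map_add, map_add, hn y (Ideal.pow_le_pow_right (Nat.le_add_right n m) hy),
        hm y (Ideal.pow_le_pow_right (Nat.le_add_left m n) hy), add_zero]
    | tmul c d =>
      obtain ⟨n, -, hn⟩ := hU c.2
      refine ⟨n, fun y hy z => ?_⟩
      have h0 : (FiniteDual.ev y ∘ₗ p) c = 0 := hn y hy
      rw [LinearMap.rTensor_tmul, formMul_tmul, Submodule.subtype_apply, h0, zero_mul]
  obtain ⟨n, hn⟩ := hfin t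
  -- For `y ∈ 𝔞^n` and `z ∈ 𝔞`, evaluate `Δ(b)` at `y ⊗ z`: the part from `U ⊗ B` dies because of
  -- `y`, and `b ⊗ 1` because `ε(z) = 0`. The extra power is the one used by `z`.
  refine ⟨n + 1, by omega, fun x hx => ?_⟩
  rw [Submodule.pow_succ] at hx
  refine Ideal.linearMap_eq_zero_of_mem_mul (k := k) (φ b).toLin (fun y hy z hz => ?_) hx
  have h1 := FiniteDual.formMul_comul_apply φ b y z
  rw [← sub_add_cancel (comul b) (b ⊗ₜ[k] (1 : B)), map_add, ← ht] at h1
  refine h1.symm.trans ?_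
  have h2 : (FiniteDual.ev z ∘ₗ p) 1 = 0 := by
    change φ 1 z = 0
    rw [map_one, FiniteDual.one_apply]
    exact hz
  refine (congrArg₂ (· + ·) (hn y hy z) ((formMul_tmul _ _ _ _).trans
    ((congrArg _ h2).trans (mul_zero _)))).trans (add_zero 0)

/-- The group scheme `Spec R†` is unipotent. -/
theorem exists_fixed_of_isCoaction_unipotentDual (h : (unipotentDual k R).IsHopfSubalgebra)
    {V : Type*} [AddCommGroup V] [Module k V] [Nontrivial V] (ρ : V →ₗ[k] V ⊗[k] h.Carrier)
    (hρ : IsCoaction ρ) : ∃ v : V, v ≠ 0 ∧ ρ v = v ⊗ₜ 1 := by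
  let e : R → h.Carrier →ₗ[k] k := fun x => FiniteDual.ev x ∘ₗ h.val.toLinearMap
  have he1 : e 1 = counit := rfl
  have hemul : ∀ x y, formMul (e x) (e y) ∘ₗ comul = e (x * y) := fun x y => by
    ext a
    have h1 : TensorProduct.map h.val.toLinearMap h.val.toLinearMap (comul (R := k) a) =
        comul (R := k) (h.val a) := h.map_comul a
    rw [LinearMap.comp_apply, ← formMul_map, h1, FiniteDual.formMul_comul]
    rfl
  have hmul : ∀ x y v, comoduleAct ρ (e x) (comoduleAct ρ (e y) v) = comoduleAct ρ (e (x * y)) v :=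
    fun x y v => by rw [hρ.act_comp_act, hemul]
  have hone : ∀ v, comoduleAct ρ (e 1) v = v := fun v => by rw [he1, hρ.act_counit]
  -- The action is locally nilpotent on `𝔞`: only finitely many elements of `R†` occur in `ρ v`.
  have hnil : ∀ v, ∃ n : ℕ, ∀ x ∈ augmentationIdeal k R ^ n, comoduleAct ρ (e x) v = 0 := by
    intro v
    simp only [comoduleAct_apply]
    induction ρ v using TensorProduct.induction_on with
    | zero => exact ⟨0, fun _ _ => by simp only [map_zero]⟩
    | add s t hs ht =>
      obtain ⟨n, hn⟩ := hs
      obtain ⟨m, hm⟩ := ht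
      refine ⟨n + m, fun y hy => ?_⟩
      rw [map_add, map_add, hn y (Ideal.pow_le_pow_right (Nat.le_add_right n m) hy),
        hm y (Ideal.pow_le_pow_right (Nat.le_add_left m n) hy), add_zero]
    | tmul c d =>
      obtain ⟨n, -, hn⟩ := d.2
      refine ⟨n, fun y hy => ?_⟩
      have h0 : e y d = 0 := hn y hy
      rw [LinearMap.lTensor_tmul, h0, TensorProduct.tmul_zero, map_zero]
  -- If `𝔞` kills `v`, each `x` acts on `v` as `ε(x)`, which is also the value at `x` of the unit of
  -- `R†`. Evaluations at points of `R` separate `R†`, so `ρ v` and `v ⊗ 1` agree.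
  have hfix : ∀ v, (∀ x ∈ augmentationIdeal k R, comoduleAct ρ (e x) v = 0) → ρ v = v ⊗ₜ 1 := by
    intro v hv
    refine eq_of_formMul_eq (fun l : Module.Dual k V => l) e
      (fun w hw => (Module.forall_dual_apply_eq_zero_iff k w).mp hw)
      (fun w hw => h.val_injective (FiniteDual.ext hw)) fun l x => ?_
    rw [← apply_comoduleAct, formMul_tmul]
    have h1 := hv _ (sub_algebraMap_counit_mem_augmentationIdeal x)
    have h2 : e x = e (x - algebraMap k R (counit x)) + counit (R := k) x • e 1 := by
      ext a
      change h.val a x = h.val a (x - algebraMap k R (counit x)) + counit x * h.val a 1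
      rw [map_sub, Algebra.algebraMap_eq_smul_one, map_smul, smul_eq_mul, sub_add_cancel]
    have h3 : e x 1 = counit (R := k) x := rfl
    have h4 : comoduleAct ρ (e x) v = counit (R := k) x • v := by
      rw [h2, comoduleAct_apply, LinearMap.lTensor_add, LinearMap.lTensor_smul,
        LinearMap.add_apply, LinearMap.smul_apply, map_add, map_smul, ← comoduleAct_apply,
        ← comoduleAct_apply, h1, hone, zero_add]
    rw [h3, h4, map_smul, smul_eq_mul, mul_comm]
  obtain ⟨v, hv⟩ := exists_ne (0 : V)
  classical
  have hmin := Nat.find_spec (hnil v)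
  -- The minimal exponent is not `0`, since `1 ∈ 𝔞^0` acts as the identity and `v ≠ 0`. If it is `m
  -- + 1`, some `y ∈ 𝔞^m` has `yv ≠ 0`, and `𝔞` kills `yv`.
  rcases hn : Nat.find (hnil v) with _ | m
  · rw [hn] at hmin
    refine absurd ((hone v).symm.trans (hmin 1 ?_)) hv
    rw [Submodule.pow_zero, Ideal.one_eq_top]
    trivial
  · rw [hn] at hmin
    have hm : ¬ ∀ x ∈ augmentationIdeal k R ^ m, comoduleAct ρ (e x) v = 0 :=
      Nat.find_min (hnil v) (by omega)
    push Not at hm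
    obtain ⟨y, hy, hyv⟩ := hm
    refine ⟨_, hyv, hfix _ fun x hx => ?_⟩
    rw [hmul]
    refine hmin _ ?_
    rw [Ideal.IsTwoSided.pow_succ]
    exact Ideal.mul_mem_mul hx hy

theorem isLargestQuotient_unipotentDual (h : (unipotentDual k R).IsHopfSubalgebra) :
    IsLargestQuotient IsUnipotentGrpSch (specGrpMap h.incl) := by
  refine isLargestQuotient_specGrpMap _ _ h.val_injective
    ⟨h.Carrier, inferInstance, inferInstance, ⟨Iso.refl _⟩,
      fun V _ _ _ ρ hρ => exists_fixed_of_isCoaction_unipotentDual h ρ hρ⟩ ?_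
  rintro H - ⟨C, _, _, e, hC⟩
  exact ⟨C, _, _, e, fun φ c => ⟨⟨φ c, mem_unipotentDual_of_forall_exists_fixed hC φ c⟩, rfl⟩⟩

end Unipotent

theorem mainTheorem12 {k : Type u} [Field k] {R : Type u} [Ring R] [hR : HopfAlgebra k R]
    [IsCocomm k R] :
    (unipotentDual k R).IsHopfSubalgebra ∧
    (∃! h : HopfAlgebra k (RingAb R),
      h.toAlgebra = RingAb.algebra k R ∧ IsHopfHom k hR h (RingAb.proj R)) ∧
    (∀ (_ : HopfAlgebra k (RingAb R)) (π : R →ₐc[k] RingAb R), (∀ x, π x = RingAb.proj R x) →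
      ∃ _ : IsCocomm k (RingAb R),
        IsLargestQuotient IsAbelianGrpSch (specGrpMap (FiniteDual.map π))) ∧
    (∃ h : (unipotentDual k R).IsHopfSubalgebra,
      IsLargestQuotient IsUnipotentGrpSch (specGrpMap h.incl)) := by
  refine ⟨isHopfSubalgebra_unipotentDual, RingAb.existsUnique_hopfAlgebra, fun _ π hπ => ?_,
    isHopfSubalgebra_unipotentDual, isLargestQuotient_unipotentDual _⟩
  -- Cocommutativity comes first: it makes `(R^ab)°` a commutative ring, which its spectrum
  -- requires.
  have : IsCocomm k (RingAb R) := isCocomm_of_surjective π fun y =>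
    (RingAb.proj_surjective R y).imp fun x hx => (hπ x).trans hx
  exact ⟨this, isLargestQuotient_ringAb π hπ⟩
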